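/- Consider the real RAM: exact real numbers with unit-cost $+,-,\times,/$ and comparisons, unit-cost arithmetic and comparisons on integer words of $O(\log(|V|+2))$ bits, indirect addressing, and no rounding of reals to integers. There is a single deterministic real RAM program with the following property. Let $G=(U\cup V,\,U\times V,\,c)$ be any complete bipartite graph with finite sides $U=\{0,\dots,|U|-1\}$ and $V=\{0,\dots,|V|-1\}$, $|U|\le|V|$, and arbitrary real edge weights $c:U\times V\to\mathbb{R}$. Suppose that the program is given $|U|$ and $|V|$ and has read-only access to $c$, where each query $(u,v)\mapsto c(u,v)$ takes one time step. Then the program halts after $O(|U|^3+|U||V|+1)$ steps, uses $O(|V|+1)$ memory cells (words and reals), and outputs a cheapest matching of $U$ to $V$, that is, an injective map $f:U\to V$ that minimizes $\sum_{u\in U}c(u,f(u))$ among all injective maps $U\to V$; it leaves $f(0),\dots,f(|U|-1)$ in its word memory. The constants in the $O$-bounds are absolute: they do not depend on $U$, $V$ or $c$. (The summands $+1$ matter only if $U$ or $V$ is empty.) -/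

import Mathlib

/-! ## A real RAM with read-only access to a matrix of weights

Two kinds of data: *words* (natural numbers below a fixed bound `B`) and *real numbers* (exact).
There are finitely many registers of either kind in any one program, named by the program text, and
two addressable memories, `S` cells of words and `S` cells of reals.  Every instruction and every
test costs one time step.  Words and reals interact only through comparison tests and through the
conversion of a word to a real: there is no rounding operation. -/

namespace RealRAM

/-- Arithmetic on words. -/
inductive WordOp
  | add | sub | mul | div | mod

/-- Subtraction is truncated at `0`; division and remainder by `0` are undefined. -/
def WordOp.eval : WordOp → ℕ → ℕ → Option ℕ
  | .add, x, y => some (x + y)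
  | .sub, x, y => some (x - y)
  | .mul, x, y => some (x * y)
  | .div, x, y => if y = 0 then none else some (x / y)
  | .mod, x, y => if y = 0 then none else some (x % y)

/-- Exact arithmetic on reals. -/
inductive RealOp
  | add | sub | mul | div

open Classical in
/-- Division by `0` is undefined. -/
noncomputable def RealOp.eval : RealOp → ℝ → ℝ → Option ℝ
  | .add, x, y => some (x + y)
  | .sub, x, y => some (x - y)
  | .mul, x, y => some (x * y)
  | .div, x, y => if y = 0 then none else some (x / y)

/-- Comparison tests between two word registers or two real registers. -/
inductive Test
  | wordLt (a b : ℕ)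
  | wordEq (a b : ℕ)
  | realLt (a b : ℕ)
  | realEq (a b : ℕ)

/-- Programs: instructions, sequencing, branching and loops.  The numbers `d`, `a`, `b`, `s` are
names of registers. -/
inductive Prog
  /-- the empty program -/
  | skip
  /-- word register `d` becomes the constant `n` -/
  | wordConst (d n : ℕ)
  /-- word register `d` becomes the result of `op` on the word registers `a`, `b` -/
  | wordOp (op : WordOp) (d a b : ℕ)
  /-- word register `d` becomes the word memory cell whose address is in word register `a` -/
  | wordLoad (d a : ℕ)
  /-- the word memory cell whose address is in word register `a` becomes word register `s` -/
  | wordStore (a s : ℕ)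
  /-- real register `d` becomes word register `a`, converted to a real -/
  | realOfWord (d a : ℕ)
  /-- real register `d` becomes the result of `op` on the real registers `a`, `b` -/
  | realOp (op : RealOp) (d a b : ℕ)
  /-- real register `d` becomes the real memory cell whose address is in word register `a` -/
  | realLoad (d a : ℕ)
  /-- the real memory cell whose address is in word register `a` becomes real register `s` -/
  | realStore (a s : ℕ)
  /-- real register `d` becomes the weight of the edge from the left vertex whose number is in word
  register `a` to the right vertex whose number is in word register `b` -/
  | query (d a b : ℕ)
  /-- first `P`, then `Q` -/
  | seq (P Q : Prog)
  /-- `P` if the test succeeds, `Q` otherwise -/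
  | branch (b : Test) (P Q : Prog)
  /-- repeat `P` as long as the test succeeds -/
  | loop (b : Test) (P : Prog)

/-- Contents of the registers and of the memories. -/
structure State where
  wordReg : ℕ → ℕ
  realReg : ℕ → ℝ
  wordMem : ℕ → ℕ
  realMem : ℕ → ℝ

/-- Initially, word registers `0` and `1` hold the numbers of left and right vertices; everything
else is `0`. -/
def State.start (p q : ℕ) : State where
  wordReg := fun i => if i = 0 then p else if i = 1 then q else 0
  realReg := fun _ => 0
  wordMem := fun _ => 0
  realMem := fun _ => 0

def State.setWordReg (σ : State) (d x : ℕ) : State :=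
  { σ with wordReg := Function.update σ.wordReg d x }

def State.setRealReg (σ : State) (d : ℕ) (x : ℝ) : State :=
  { σ with realReg := Function.update σ.realReg d x }

def State.setWordMem (σ : State) (i x : ℕ) : State :=
  { σ with wordMem := Function.update σ.wordMem i x }

def State.setRealMem (σ : State) (i : ℕ) (x : ℝ) : State :=
  { σ with realMem := Function.update σ.realMem i x }

def Test.Holds (σ : State) : Test → Prop
  | .wordLt a b => σ.wordReg a < σ.wordReg b
  | .wordEq a b => σ.wordReg a = σ.wordReg b
  | .realLt a b => σ.realReg a < σ.realReg b
  | .realEq a b => σ.realReg a = σ.realReg b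

/-- `Exec c S B P σ t τ`: on a machine with `S` cells of word memory, `S` cells of real memory and
words less than `B`, with read-only access to the weights `c`, the program `P` started in `σ` halts
after exactly `t` steps in `τ`.  An access to a memory cell with address at least `S`, a word that
reaches `B`, an undefined arithmetic operation, or a query for an edge that does not exist is an
error: there is then no execution. -/
inductive Exec {p q : ℕ} (c : Fin p → Fin q → ℝ) (S B : ℕ) :
    Prog → State → ℕ → State → Prop
  | skip (σ : State) : Exec c S B .skip σ 0 σ
  | wordConst (σ : State) (d n : ℕ) (hB : n < B) :
      Exec c S B (.wordConst d n) σ 1 (σ.setWordReg d n)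
  | wordOp (σ : State) (op : WordOp) (d a b x : ℕ)
      (hx : op.eval (σ.wordReg a) (σ.wordReg b) = some x) (hB : x < B) :
      Exec c S B (.wordOp op d a b) σ 1 (σ.setWordReg d x)
  | wordLoad (σ : State) (d a : ℕ) (hS : σ.wordReg a < S) :
      Exec c S B (.wordLoad d a) σ 1 (σ.setWordReg d (σ.wordMem (σ.wordReg a)))
  | wordStore (σ : State) (a s : ℕ) (hS : σ.wordReg a < S) :
      Exec c S B (.wordStore a s) σ 1 (σ.setWordMem (σ.wordReg a) (σ.wordReg s))
  | realOfWord (σ : State) (d a : ℕ) :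
      Exec c S B (.realOfWord d a) σ 1 (σ.setRealReg d (σ.wordReg a : ℝ))
  | realOp (σ : State) (op : RealOp) (d a b : ℕ) (x : ℝ)
      (hx : op.eval (σ.realReg a) (σ.realReg b) = some x) :
      Exec c S B (.realOp op d a b) σ 1 (σ.setRealReg d x)
  | realLoad (σ : State) (d a : ℕ) (hS : σ.wordReg a < S) :
      Exec c S B (.realLoad d a) σ 1 (σ.setRealReg d (σ.realMem (σ.wordReg a)))
  | realStore (σ : State) (a s : ℕ) (hS : σ.wordReg a < S) :
      Exec c S B (.realStore a s) σ 1 (σ.setRealMem (σ.wordReg a) (σ.realReg s))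
  | query (σ : State) (d a b : ℕ) (hu : σ.wordReg a < p) (hv : σ.wordReg b < q) :
      Exec c S B (.query d a b) σ 1
        (σ.setRealReg d (c ⟨σ.wordReg a, hu⟩ ⟨σ.wordReg b, hv⟩))
  | seq {P Q : Prog} {σ τ υ : State} {t t' : ℕ}
      (hP : Exec c S B P σ t τ) (hQ : Exec c S B Q τ t' υ) :
      Exec c S B (.seq P Q) σ (t + t') υ
  | branch_true {b : Test} {P Q : Prog} {σ τ : State} {t : ℕ}
      (hb : b.Holds σ) (hP : Exec c S B P σ t τ) :
      Exec c S B (.branch b P Q) σ (t + 1) τ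
  | branch_false {b : Test} {P Q : Prog} {σ τ : State} {t : ℕ}
      (hb : ¬ b.Holds σ) (hQ : Exec c S B Q σ t τ) :
      Exec c S B (.branch b P Q) σ (t + 1) τ
  | loop_false {b : Test} {P : Prog} {σ : State} (hb : ¬ b.Holds σ) :
      Exec c S B (.loop b P) σ 1 σ
  | loop_true {b : Test} {P : Prog} {σ τ υ : State} {t t' : ℕ}
      (hb : b.Holds σ) (hP : Exec c S B P σ t τ) (hL : Exec c S B (.loop b P) τ t' υ) :
      Exec c S B (.loop b P) σ (t + 1 + t') υ

end RealRAM

/-- The cost of the matching of `U` to `V` that consists of the edges `(u, f u)`. -/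
def matchingCost {U V : Type*} [Fintype U] (c : U → V → ℝ) (f : U ↪ V) : ℝ :=
  ∑ u, c u (f u)

/-- `f` is a cheapest matching of `U` to `V`.  A matching of `U` to `V` is a set of pairwise disjoint
edges that covers `U`, that is, an injective map from `U` to `V`. -/
def IsCheapestMatching {U V : Type*} [Fintype U] (c : U → V → ℝ) (f : U ↪ V) : Prop :=
  ∀ g : U ↪ V, matchingCost c f ≤ matchingCost c g

/-! ## A small array language compiled to programs -/

namespace RealRAM

/-! The algorithm is the Hungarian method by successive shortest paths, with a table that keeps the
large side $V$ out of the inner search. Write $p=|U|$, $q=|V|$.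

Left vertices are matched one at a time. The invariant `Equilibrium` is linear programming duality:
right vertices carry nonnegative prices that vanish on free vertices, and every matched left vertex
$i$ uses a right vertex minimizing $c(i,v)+\mathrm{price}(v)$. When all left vertices are matched,
summing these inequalities against any other matching $g$ gives optimality, because $f$ collects all
the prices and $g$ at most all of them (`Equilibrium.cheapest`).

To match vertex $k$, Dijkstra's algorithm runs from $k$ over the matched left vertices. A step goes
from $u$ to a matched right vertex $f(i)$ and back along the matching edge to $i$. Here `dist i` is
the distance of $f(i)$, and `off i` that of $i$ itself, so that `off u` plus the priced weight of
$uv$ is the length of reaching $v$ through $u$. Equilibrium makes all reduced weights nonnegative,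
which gives `SearchState.scan`. Let $\delta$ be the least length of reaching a free vertex. Raising
the price of each $f(i)$ by $\max(0,\delta-\mathrm{dist}(i))$ makes every `off u` plus new priced
weight at least $\delta$ (`Equilibrium.Raised.delta_le`), with equality on the augmenting path;
hence the augmented matching is again in equilibrium (`Equilibrium.Raised.equilibrium_succ`).

For the time bound, $V$ is cut into $\lfloor q/p\rfloor+1$ blocks of at most $p$ vertices, and for
each left vertex and block the cheapest free vertex is stored. The table has $p(\lfloor
q/p\rfloor+1)\le 2q$ entries and costs $O(pq+p^2)$ to build. In each phase the search costs $O(p^2)$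
and finding $\delta$ costs $O(p+q)$. Only the block of the newly matched right vertex must be
recomputed (`IsBlockMin.take`), for $O(p^2)$. The $p$ phases thus cost $O(p^3+pq)$.

The algorithm is written in a small array language. Its compilation is verified once, through rules
(`Runs`) that carry a clock along with the store. -/

/-- Word variables. -/
inductive WVar
  | p | q | nb | k | i | j | n | u | b | v | best | pf | vf
  deriving DecidableEq

/-- Real variables. -/
inductive RVar
  | cand | delta
  deriving DecidableEq

/-- Arrays of words. -/
inductive WArr
  | f | taken | pred | rank | blk
  deriving DecidableEq

/-- Arrays of reals. -/
inductive RArr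
  | dist | off | price
  deriving DecidableEq

/-- Registers `0` and `1` are those that hold the two sizes at the start. -/
def WVar.idx : WVar → ℕ
  | p => 0 | q => 1 | nb => 2 | k => 3 | i => 4 | j => 5 | n => 6 | u => 7 | b => 8 | v => 9
  | best => 10 | pf => 11 | vf => 12

def RVar.idx : RVar → ℕ
  | cand => 0 | delta => 1

/-- The matching has index `0`, so it lies at the addresses where the output is expected. -/
def WArr.idx : WArr → ℕ
  | f => 0 | taken => 1 | pred => 2 | rank => 3 | blk => 4

def RArr.idx : RArr → ℕ
  | dist => 0 | off => 1 | price => 2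

lemma WVar.idx_lt (x : WVar) : x.idx < 20 := by cases x <;> simp [idx]

lemma RVar.idx_lt (x : RVar) : x.idx < 20 := by cases x <;> simp [idx]

lemma WArr.idx_lt (a : WArr) : a.idx < 5 := by cases a <;> simp [idx]

lemma RArr.idx_lt (a : RArr) : a.idx < 5 := by cases a <;> simp [idx]

lemma WVar.idx_inj : Function.Injective WVar.idx := by
  intro x y h; cases x <;> cases y <;> simp_all [idx]

lemma RVar.idx_inj : Function.Injective RVar.idx := by
  intro x y h; cases x <;> cases y <;> simp_all [idx]

lemma WArr.idx_inj : Function.Injective WArr.idx := by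
  intro x y h; cases x <;> cases y <;> simp_all [idx]

lemma RArr.idx_inj : Function.Injective RArr.idx := by
  intro x y h; cases x <;> cases y <;> simp_all [idx]

/-- Values of the variables and arrays, and the time elapsed. -/
structure Store where
  word : WVar → ℕ
  real : RVar → ℝ
  warr : WArr → ℕ → ℕ
  rarr : RArr → ℕ → ℝ
  time : ℕ

namespace Store

def tick (α : Store) (t : ℕ) : Store := { α with time := α.time + t }

def setWord (α : Store) (x : WVar) (m : ℕ) : Store :=
  { α with word := Function.update α.word x m }

def setReal (α : Store) (x : RVar) (m : ℝ) : Store :=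
  { α with real := Function.update α.real x m }

def putWord (α : Store) (a : WArr) (i m : ℕ) : Store :=
  { α with warr := Function.update α.warr a (Function.update (α.warr a) i m) }

def putReal (α : Store) (a : RArr) (i : ℕ) (m : ℝ) : Store :=
  { α with rarr := Function.update α.rarr a (Function.update (α.rarr a) i m) }

variable (α : Store) (t i m : ℕ) (r : ℝ) (x : WVar) (y : RVar) (a : WArr) (d : RArr)

@[simp] lemma tick_word : (α.tick t).word = α.word := rfl
@[simp] lemma tick_real : (α.tick t).real = α.real := rfl
@[simp] lemma tick_warr : (α.tick t).warr = α.warr := rfl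
@[simp] lemma tick_rarr : (α.tick t).rarr = α.rarr := rfl
@[simp] lemma tick_time : (α.tick t).time = α.time + t := rfl
@[simp] lemma setWord_word : (α.setWord x m).word = Function.update α.word x m := rfl
@[simp] lemma setWord_real : (α.setWord x m).real = α.real := rfl
@[simp] lemma setWord_warr : (α.setWord x m).warr = α.warr := rfl
@[simp] lemma setWord_rarr : (α.setWord x m).rarr = α.rarr := rfl
@[simp] lemma setWord_time : (α.setWord x m).time = α.time := rfl
@[simp] lemma setReal_word : (α.setReal y r).word = α.word := rfl
@[simp] lemma setReal_real : (α.setReal y r).real = Function.update α.real y r := rfl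
@[simp] lemma setReal_warr : (α.setReal y r).warr = α.warr := rfl
@[simp] lemma setReal_rarr : (α.setReal y r).rarr = α.rarr := rfl
@[simp] lemma setReal_time : (α.setReal y r).time = α.time := rfl
@[simp] lemma putWord_word : (α.putWord a i m).word = α.word := rfl
@[simp] lemma putWord_real : (α.putWord a i m).real = α.real := rfl
@[simp] lemma putWord_warr : (α.putWord a i m).warr =
    Function.update α.warr a (Function.update (α.warr a) i m) := rfl
@[simp] lemma putWord_rarr : (α.putWord a i m).rarr = α.rarr := rfl
@[simp] lemma putWord_time : (α.putWord a i m).time = α.time := rfl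
@[simp] lemma putReal_word : (α.putReal d i r).word = α.word := rfl
@[simp] lemma putReal_real : (α.putReal d i r).real = α.real := rfl
@[simp] lemma putReal_warr : (α.putReal d i r).warr = α.warr := rfl
@[simp] lemma putReal_rarr : (α.putReal d i r).rarr =
    Function.update α.rarr d (Function.update (α.rarr d) i r) := rfl
@[simp] lemma putReal_time : (α.putReal d i r).time = α.time := rfl

end Store

/-! ### Representation of stores in machine states. -/

/-- The state `σ` represents the store `α`: registers below `20` hold the variables, register `20`
holds the distance between the beginnings of consecutive arrays, and all words are below `B`. -/
structure Rel (q B : ℕ) (α : Store) (σ : State) : Prop where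
  word : ∀ x : WVar, σ.wordReg x.idx = α.word x
  stride : σ.wordReg 20 = 2 * q + 2
  real : ∀ x : RVar, σ.realReg x.idx = α.real x
  warr : ∀ (a : WArr) (i : ℕ), i < 2 * q + 2 → σ.wordMem (a.idx * (2 * q + 2) + i) = α.warr a i
  rarr : ∀ (a : RArr) (i : ℕ), i < 2 * q + 2 → σ.realMem (a.idx * (2 * q + 2) + i) = α.rarr a i
  reg_lt : ∀ d, σ.wordReg d < B
  mem_lt : ∀ d, σ.wordMem d < B

lemma Rel.tick {q B : ℕ} {α : Store} {σ : State} (h : Rel q B α σ) (t : ℕ) :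
    Rel q B (α.tick t) σ := ⟨h.1, h.2, h.3, h.4, h.5, h.6, h.7⟩

lemma update_lt {B : ℕ} {g : ℕ → ℕ} (h : ∀ d, g d < B) (t : ℕ) {m : ℕ} (hm : m < B) (d : ℕ) :
    Function.update g t m d < B := by
  by_cases hd : d = t
  · subst hd; simpa
  · simpa [hd] using h d

lemma Rel.setTemp {q B : ℕ} {α : Store} {σ : State} (h : Rel q B α σ) {t m : ℕ} (ht : 21 ≤ t)
    (hm : m < B) : Rel q B α (σ.setWordReg t m) where
  word x := by
    have := x.idx_lt
    simpa [State.setWordReg, show x.idx ≠ t by omega] using h.word x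
  stride := by simpa [State.setWordReg, show 20 ≠ t by omega] using h.stride
  real := h.real
  warr := h.warr
  rarr := h.rarr
  reg_lt := update_lt h.reg_lt t hm
  mem_lt := h.mem_lt

lemma Rel.setRealTemp {q B : ℕ} {α : Store} {σ : State} (h : Rel q B α σ) {t : ℕ} {r : ℝ}
    (ht : 21 ≤ t) : Rel q B α (σ.setRealReg t r) where
  word := h.word
  stride := h.stride
  real x := by
    have := x.idx_lt
    simpa [State.setRealReg, show x.idx ≠ t by omega] using h.real x
  warr := h.warr
  rarr := h.rarr
  reg_lt := h.reg_lt
  mem_lt := h.mem_lt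

lemma Rel.setWord {q B : ℕ} {α : Store} {σ : State} (h : Rel q B α σ) (x : WVar) {m : ℕ}
    (hm : m < B) : Rel q B (α.setWord x m) (σ.setWordReg x.idx m) where
  word y := by
    by_cases hy : y = x
    · subst hy; simp [State.setWordReg]
    · simpa [State.setWordReg, hy, WVar.idx_inj.ne hy] using h.word y
  stride := by
    have := x.idx_lt
    simpa [State.setWordReg, show 20 ≠ x.idx by omega] using h.stride
  real := h.real
  warr := h.warr
  rarr := h.rarr
  reg_lt := update_lt h.reg_lt _ hm
  mem_lt := h.mem_lt

lemma Rel.setReal {q B : ℕ} {α : Store} {σ : State} (h : Rel q B α σ) (x : RVar) (r : ℝ) :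
    Rel q B (α.setReal x r) (σ.setRealReg x.idx r) where
  word := h.word
  stride := h.stride
  real y := by
    by_cases hy : y = x
    · subst hy; simp [State.setRealReg]
    · simpa [State.setRealReg, hy, RVar.idx_inj.ne hy] using h.real y
  warr := h.warr
  rarr := h.rarr
  reg_lt := h.reg_lt
  mem_lt := h.mem_lt

lemma address_inj {N a a' i i' : ℕ} (hi : i < N) (hi' : i' < N) (h : a * N + i = a' * N + i') :
    a = a' ∧ i = i' := by
  have h1 : (a * N + i) / N = a := by
    rw [mul_comm, Nat.mul_add_div (by omega), Nat.div_eq_of_lt hi]; rfl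
  have h2 : (a' * N + i') / N = a' := by
    rw [mul_comm, Nat.mul_add_div (by omega), Nat.div_eq_of_lt hi']; rfl
  have h3 : a = a' := by rw [← h1, ← h2, h]
  subst h3
  exact ⟨rfl, by omega⟩

/-- Five arrays of length `2 * q + 2` fill `10 * (q + 1)` cells; this is the source of that bound
throughout. -/
lemma address_lt {q a i : ℕ} (ha : a < 5) (hi : i < 2 * q + 2) :
    a * (2 * q + 2) + i < 10 * (q + 1) := by
  have : a * (2 * q + 2) ≤ 4 * (2 * q + 2) := Nat.mul_le_mul_right _ (by omega)
  omega

lemma Rel.putWord {q B : ℕ} {α : Store} {σ : State} (h : Rel q B α σ) (a : WArr) {i m : ℕ}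
    (hi : i < 2 * q + 2) (hm : m < B) :
    Rel q B (α.putWord a i m) (σ.setWordMem (a.idx * (2 * q + 2) + i) m) where
  word := h.word
  stride := h.stride
  real := h.real
  warr a' i' hi' := by
    by_cases he : a' = a
    · subst he
      by_cases hi2 : i' = i
      · subst hi2; simp [State.setWordMem]
      · simpa [State.setWordMem, hi2] using h.warr a' i' hi'
    · have : a'.idx * (2 * q + 2) + i' ≠ a.idx * (2 * q + 2) + i := fun h' =>
        he (WArr.idx_inj (address_inj hi' hi h').1)
      simpa [State.setWordMem, this, he] using h.warr a' i' hi'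
  rarr := h.rarr
  reg_lt := h.reg_lt
  mem_lt := update_lt h.mem_lt _ hm

lemma Rel.putReal {q B : ℕ} {α : Store} {σ : State} (h : Rel q B α σ) (a : RArr) {i : ℕ} (r : ℝ)
    (hi : i < 2 * q + 2) :
    Rel q B (α.putReal a i r) (σ.setRealMem (a.idx * (2 * q + 2) + i) r) where
  word := h.word
  stride := h.stride
  real := h.real
  warr := h.warr
  rarr a' i' hi' := by
    by_cases he : a' = a
    · subst he
      by_cases hi2 : i' = i
      · subst hi2; simp [State.setRealMem]
      · simpa [State.setRealMem, hi2] using h.rarr a' i' hi'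
    · have : a'.idx * (2 * q + 2) + i' ≠ a.idx * (2 * q + 2) + i := fun h' =>
        he (RArr.idx_inj (address_inj hi' hi h').1)
      simpa [State.setRealMem, this, he] using h.rarr a' i' hi'
  reg_lt := h.reg_lt
  mem_lt := h.mem_lt

/-! ### Compilation of expressions and conditions. -/

/-- Word expressions. -/
inductive WExp
  | var (x : WVar)
  | lit (n : ℕ)
  | add (e e' : WExp)
  | mul (e e' : WExp)
  | div (e e' : WExp)
  | get (a : WArr) (e : WExp)

namespace WExp

def eval (α : Store) : WExp → ℕ
  | var x => α.word x
  | lit n => n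
  | add e e' => e.eval α + e'.eval α
  | mul e e' => e.eval α * e'.eval α
  | div e e' => e.eval α / e'.eval α
  | get a e => α.warr a (e.eval α)

/-- The evaluation meets no error. -/
def Ok (q B : ℕ) (α : Store) : WExp → Prop
  | var _ => True
  | lit n => n < B
  | add e e' => e.Ok q B α ∧ e'.Ok q B α ∧ e.eval α + e'.eval α < B
  | mul e e' => e.Ok q B α ∧ e'.Ok q B α ∧ e.eval α * e'.eval α < B
  | div e e' => e.Ok q B α ∧ e'.Ok q B α ∧ e'.eval α ≠ 0
  | get _ e => e.Ok q B α ∧ e.eval α < 2 * q + 2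

def cost : WExp → ℕ
  | var _ => 2
  | lit _ => 1
  | add e e' => e.cost + e'.cost + 1
  | mul e e' => e.cost + e'.cost + 1
  | div e e' => e.cost + e'.cost + 1
  | get _ e => e.cost + 4

/-- Code that leaves the value in word register `t` and changes only word registers from `t` on. -/
def code : WExp → ℕ → Prog
  -- The machine has no move instruction, so a register is copied by adding `0`.
  | var x, t => .seq (.wordConst t 0) (.wordOp .add t x.idx t)
  | lit n, t => .wordConst t n
  | add e e', t => .seq (.seq (e.code t) (e'.code (t + 1))) (.wordOp .add t t (t + 1))
  | mul e e', t => .seq (.seq (e.code t) (e'.code (t + 1))) (.wordOp .mul t t (t + 1))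
  | div e e', t => .seq (.seq (e.code t) (e'.code (t + 1))) (.wordOp .div t t (t + 1))
  | get a e, t => .seq (e.code t) (.seq (.wordConst (t + 1) a.idx)
      (.seq (.wordOp .mul (t + 1) (t + 1) 20) (.seq (.wordOp .add t (t + 1) t) (.wordLoad t t))))

end WExp

variable {p q : ℕ} {c : Fin p → Fin q → ℝ} {S B : ℕ}

/-- `τ` is `σ` except for temporary registers from `t` on. -/
structure Extends (q B : ℕ) (α : Store) (t : ℕ) (σ τ : State) : Prop where
  rel : Rel q B α τ
  word : ∀ d < t, τ.wordReg d = σ.wordReg d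
  real : ∀ d < t, τ.realReg d = σ.realReg d

lemma Extends.trans {α : Store} {t t' : ℕ} {σ τ υ : State} (h : Extends q B α t σ τ)
    (h' : Extends q B α t' τ υ) (ht : t ≤ t') : Extends q B α t σ υ :=
  ⟨h'.rel, fun d hd => by rw [h'.word d (by omega), h.word d hd],
    fun d hd => by rw [h'.real d (by omega), h.real d hd]⟩

lemma Rel.extends_word {α : Store} {σ : State} (h : Rel q B α σ) {t m : ℕ} (ht : 21 ≤ t)
    (hm : m < B) : Extends q B α t σ (σ.setWordReg t m) :=
  ⟨h.setTemp ht hm, fun d hd => by simp [State.setWordReg, show d ≠ t by omega], fun _ _ => rfl⟩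

lemma Rel.extends_real {α : Store} {σ : State} (h : Rel q B α σ) {t : ℕ} {r : ℝ} (ht : 21 ≤ t) :
    Extends q B α t σ (σ.setRealReg t r) :=
  ⟨h.setRealTemp ht, fun _ _ => rfl, fun d hd => by simp [State.setRealReg, show d ≠ t by omega]⟩

/-- The address computation shared by all array accesses. The continuation `P` stands for the final
load or store. -/
lemma exec_address (hB : 10 * (q + 1) ≤ B) {α : Store} {σ : State} (h : Rel q B α σ) {t s a i : ℕ}
    (ht : 21 ≤ t) (hs : t < s) (ha : a < 5) (hi : i < 2 * q + 2) (hσ : σ.wordReg t = i) :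
    ∃ τ, (∀ P υ n, Exec c S B P τ n υ → Exec c S B (.seq (.wordConst s a)
      (.seq (.wordOp .mul s s 20) (.seq (.wordOp .add t s t) P))) σ (n + 3) υ) ∧
      Rel q B α τ ∧ τ.wordReg t = a * (2 * q + 2) + i ∧
      (∀ d, d ≠ t → d ≠ s → τ.wordReg d = σ.wordReg d) ∧ τ.realReg = σ.realReg ∧
      τ.wordMem = σ.wordMem ∧ τ.realMem = σ.realMem := by
  have hlt := address_lt ha hi
  refine ⟨((σ.setWordReg s a).setWordReg s (a * (2 * q + 2))).setWordReg t (a * (2 * q + 2) + i),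
    ?_, ((h.setTemp (by omega) (by omega)).setTemp (by omega) (by omega)).setTemp ht (by omega),
    by simp [State.setWordReg], ?_, rfl, rfl, rfl⟩
  · intro P υ n hP
    have := Exec.seq (Exec.wordConst (c := c) (S := S) (B := B) σ s a (by omega))
      (Exec.seq (Exec.wordOp _ .mul s s 20 (a * (2 * q + 2)) ?_ (by omega))
      (Exec.seq (Exec.wordOp _ .add t s t (a * (2 * q + 2) + i) ?_ (by omega)) hP))
    · exact (show 1 + (1 + (1 + n)) = n + 3 by omega) ▸ this
    · simp [WordOp.eval, State.setWordReg, h.stride, show 20 ≠ s by omega]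
    · simp [WordOp.eval, State.setWordReg, hσ, show t ≠ s by omega]
  · intro d h1 h2; simp [State.setWordReg, h1, h2]

lemma WExp.exec_binary {α : Store} {e e' : WExp} {o : WordOp} {t m : ℕ} {σ : State}
    (he : ∃ τ, Exec c S B (e.code t) σ e.cost τ ∧ Extends q B α t σ τ ∧
      τ.wordReg t = e.eval α)
    (he' : ∀ τ, Rel q B α τ → ∃ υ, Exec c S B (e'.code (t + 1)) τ e'.cost υ ∧
      Extends q B α (t + 1) τ υ ∧ υ.wordReg (t + 1) = e'.eval α) (ht : 21 ≤ t)
    (ho : o.eval (e.eval α) (e'.eval α) = some m) (hm : m < B) :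
    ∃ τ, Exec c S B (.seq (.seq (e.code t) (e'.code (t + 1))) (.wordOp o t t (t + 1))) σ
      (e.cost + e'.cost + 1) τ ∧ Extends q B α t σ τ ∧ τ.wordReg t = m := by
  obtain ⟨τ, h1, h2, h3⟩ := he
  obtain ⟨υ, h4, h5, h6⟩ := he' τ h2.rel
  refine ⟨_, Exec.seq (Exec.seq h1 h4) (Exec.wordOp υ o t t (t + 1) m ?_ hm),
    (h2.trans h5 (by omega)).trans (h5.rel.extends_word ht hm) le_rfl, by simp [State.setWordReg]⟩
  rw [h6, h5.word t (by omega), h3, ho]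

lemma WExp.exec (hS : 10 * (q + 1) ≤ S) (hB : 10 * (q + 1) ≤ B) {α : Store} (e : WExp)
    (ok : e.Ok q B α) {t : ℕ} (ht : 21 ≤ t) {σ : State} (h : Rel q B α σ) :
    ∃ τ, Exec c S B (e.code t) σ e.cost τ ∧ Extends q B α t σ τ ∧ τ.wordReg t = e.eval α := by
  induction e generalizing t σ with
  | var x =>
    have hx := x.idx_lt
    have hv : α.word x < B := h.word x ▸ h.reg_lt _
    refine ⟨_, Exec.seq (Exec.wordConst σ t 0 (by omega)) (Exec.wordOp _ .add t x.idx t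
      (α.word x) ?_ hv), (h.extends_word ht (by omega)).trans
      ((h.setTemp ht (by omega)).extends_word ht hv) le_rfl, by simp [State.setWordReg, eval]⟩
    simp [WordOp.eval, State.setWordReg, show x.idx ≠ t by omega, h.word]
  | lit n =>
    exact ⟨_, Exec.wordConst σ t n ok, h.extends_word ht ok, by simp [State.setWordReg, eval]⟩
  | add e e' ih ih' =>
    exact exec_binary (ih ok.1 ht h) (fun τ hτ => ih' ok.2.1 (by omega) hτ) ht rfl ok.2.2
  | mul e e' ih ih' =>
    exact exec_binary (ih ok.1 ht h) (fun τ hτ => ih' ok.2.1 (by omega) hτ) ht rfl ok.2.2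
  | div e e' ih ih' =>
    refine exec_binary (ih ok.1 ht h) (fun τ hτ => ih' ok.2.1 (by omega) hτ) ht
      (if_neg ok.2.2) ?_
    obtain ⟨τ, -, h2, h3⟩ := ih ok.1 ht h
    exact (Nat.div_le_self _ _).trans_lt (h3 ▸ h2.rel.reg_lt t)
  | get a e ih =>
    obtain ⟨τ, h1, h2, h3⟩ := ih ok.1 ht h
    obtain ⟨υ, h4, h5, h6, h7, h8, h9, h10⟩ := exec_address (c := c) (S := S) hB h2.rel ht
      (Nat.lt_succ_self t) a.idx_lt ok.2 h3
    have hval : υ.wordMem (υ.wordReg t) = α.warr a (e.eval α) := by rw [h6, h5.warr a _ ok.2]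
    have hlt : υ.wordMem (υ.wordReg t) < B := h5.mem_lt _
    refine ⟨_, Exec.seq h1 (h4 _ _ _ (Exec.wordLoad υ t t ?_)), h2.trans
      (Extends.trans (t := t) ⟨h5, fun d hd => h7 d (by omega) (by omega), fun d _ => by rw [h8]⟩
        (h5.extends_word ht hlt) le_rfl) le_rfl, by simpa [State.setWordReg, eval] using hval⟩
    rw [h6]; exact (address_lt a.idx_lt ok.2).trans_le hS

/-- Real expressions. -/
inductive RExp
  | zero
  | var (x : RVar)
  | add (e e' : RExp)
  | sub (e e' : RExp)
  | get (a : RArr) (e : WExp)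
  | weight (e e' : WExp)

open Classical in
/-- The weights as a function on all pairs of natural numbers. -/
noncomputable def extendWeight (c : Fin p → Fin q → ℝ) (u v : ℕ) : ℝ :=
  if h : u < p ∧ v < q then c ⟨u, h.1⟩ ⟨v, h.2⟩ else 0

namespace RExp

noncomputable def eval (c : Fin p → Fin q → ℝ) (α : Store) : RExp → ℝ
  | zero => 0
  | var x => α.real x
  | add e e' => e.eval c α + e'.eval c α
  | sub e e' => e.eval c α - e'.eval c α
  | get a e => α.rarr a (e.eval α)
  | weight e e' => extendWeight c (e.eval α) (e'.eval α)

/-- The evaluation meets no error. -/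
def Ok (p q B : ℕ) (α : Store) : RExp → Prop
  | zero => True
  | var _ => True
  | add e e' => e.Ok p q B α ∧ e'.Ok p q B α
  | sub e e' => e.Ok p q B α ∧ e'.Ok p q B α
  | get _ e => e.Ok q B α ∧ e.eval α < 2 * q + 2
  | weight e e' => e.Ok q B α ∧ e'.Ok q B α ∧ e.eval α < p ∧ e'.eval α < q

def cost : RExp → ℕ
  | zero => 2
  | var _ => 3
  | add e e' => e.cost + e'.cost + 1
  | sub e e' => e.cost + e'.cost + 1
  | get _ e => e.cost + 4
  | weight e e' => e.cost + (e'.cost + 1)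

/-- Code that leaves the value in real register `t` and changes only registers from `t` on. -/
def code : RExp → ℕ → Prog
  | zero, t => .seq (.wordConst t 0) (.realOfWord t t)
  | var x, t => .seq (.seq (.wordConst t 0) (.realOfWord t t)) (.realOp .add t x.idx t)
  | add e e', t => .seq (.seq (e.code t) (e'.code (t + 1))) (.realOp .add t t (t + 1))
  | sub e e', t => .seq (.seq (e.code t) (e'.code (t + 1))) (.realOp .sub t t (t + 1))
  | get a e, t => .seq (e.code t) (.seq (.wordConst (t + 1) a.idx)
      (.seq (.wordOp .mul (t + 1) (t + 1) 20) (.seq (.wordOp .add t (t + 1) t) (.realLoad t t))))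
  | weight e e', t => .seq (e.code t) (.seq (e'.code (t + 1)) (.query t t (t + 1)))

end RExp

lemma exec_zero (hB : 10 * (q + 1) ≤ B) {α : Store} {t : ℕ} (ht : 21 ≤ t) {σ : State}
    (h : Rel q B α σ) : ∃ τ, Exec c S B (.seq (.wordConst t 0) (.realOfWord t t)) σ 2 τ ∧
      Extends q B α t σ τ ∧ τ.realReg t = 0 :=
  ⟨_, Exec.seq (Exec.wordConst σ t 0 (by omega)) (Exec.realOfWord _ t t),
    (h.extends_word ht (by omega)).trans ((h.setTemp ht (by omega)).extends_real ht) le_rfl,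
    by simp [State.setRealReg, State.setWordReg]⟩

lemma RExp.exec_binary {α : Store} {e e' : RExp} {o : RealOp} {t : ℕ} {m : ℝ} {σ : State}
    (he : ∃ τ, Exec c S B (e.code t) σ e.cost τ ∧ Extends q B α t σ τ ∧
      τ.realReg t = e.eval c α)
    (he' : ∀ τ, Rel q B α τ → ∃ υ, Exec c S B (e'.code (t + 1)) τ e'.cost υ ∧
      Extends q B α (t + 1) τ υ ∧ υ.realReg (t + 1) = e'.eval c α) (ht : 21 ≤ t)
    (ho : o.eval (e.eval c α) (e'.eval c α) = some m) :
    ∃ τ, Exec c S B (.seq (.seq (e.code t) (e'.code (t + 1))) (.realOp o t t (t + 1))) σ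
      (e.cost + e'.cost + 1) τ ∧ Extends q B α t σ τ ∧ τ.realReg t = m := by
  obtain ⟨τ, h1, h2, h3⟩ := he
  obtain ⟨υ, h4, h5, h6⟩ := he' τ h2.rel
  refine ⟨_, Exec.seq (Exec.seq h1 h4) (Exec.realOp υ o t t (t + 1) m ?_),
    (h2.trans h5 (by omega)).trans (h5.rel.extends_real ht) le_rfl, by simp [State.setRealReg]⟩
  rw [h6, h5.real t (by omega), h3, ho]

lemma RExp.exec (hS : 10 * (q + 1) ≤ S) (hB : 10 * (q + 1) ≤ B) {α : Store} (e : RExp)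
    (ok : e.Ok p q B α) {t : ℕ} (ht : 21 ≤ t) {σ : State} (h : Rel q B α σ) :
    ∃ τ, Exec c S B (e.code t) σ e.cost τ ∧ Extends q B α t σ τ ∧ τ.realReg t = e.eval c α := by
  induction e generalizing t σ with
  | zero => exact exec_zero hB ht h
  | var x =>
    have hx := x.idx_lt
    obtain ⟨τ, h1, h2, h3⟩ := exec_zero (c := c) (S := S) hB ht h
    refine ⟨_, Exec.seq h1 (Exec.realOp _ .add t x.idx t (α.real x) ?_),
      h2.trans (h2.rel.extends_real ht) le_rfl, by simp [State.setRealReg, eval]⟩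
    simp [RealOp.eval, h3, h2.rel.real]
  | add e e' ih ih' =>
    exact exec_binary (ih ok.1 ht h) (fun τ hτ => ih' ok.2 (by omega) hτ) ht rfl
  | sub e e' ih ih' =>
    exact exec_binary (ih ok.1 ht h) (fun τ hτ => ih' ok.2 (by omega) hτ) ht rfl
  | get a e =>
    obtain ⟨τ, h1, h2, h3⟩ := e.exec (c := c) hS hB ok.1 ht h
    obtain ⟨υ, h4, h5, h6, h7, h8, h9, h10⟩ := exec_address (c := c) (S := S) hB h2.rel ht
      (Nat.lt_succ_self t) a.idx_lt ok.2 h3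
    have hval : υ.realMem (υ.wordReg t) = α.rarr a (e.eval α) := by rw [h6, h5.rarr a _ ok.2]
    refine ⟨_, Exec.seq h1 (h4 _ _ _ (Exec.realLoad υ t t ?_)), h2.trans
      (Extends.trans (t := t) ⟨h5, fun d hd => h7 d (by omega) (by omega), fun d _ => by rw [h8]⟩
        (h5.extends_real ht) le_rfl) le_rfl, by simpa [State.setRealReg, eval] using hval⟩
    rw [h6]; exact (address_lt a.idx_lt ok.2).trans_le hS
  | weight e e' =>
    obtain ⟨τ, h1, h2, h3⟩ := e.exec (c := c) hS hB ok.1 ht h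
    obtain ⟨υ, h4, h5, h6⟩ := e'.exec (c := c) hS hB ok.2.1 (t := t + 1) (by omega) h2.rel
    have h7 : υ.wordReg t = e.eval α := by rw [h5.word t (by omega), h3]
    refine ⟨_, Exec.seq h1 (Exec.seq h4 (Exec.query υ t t (t + 1) (h7 ▸ ok.2.2.1)
      (h6 ▸ ok.2.2.2))), (h2.trans h5 (by omega)).trans (h5.rel.extends_real ht) le_rfl, ?_⟩
    simp [State.setRealReg, eval, extendWeight, h6, h7, ok.2.2.1, ok.2.2.2]

/-- Conditions. -/
inductive Cond
  | lt (e e' : WExp)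
  | eq (e e' : WExp)
  | rlt (e e' : RExp)

namespace Cond

def Holds (c : Fin p → Fin q → ℝ) (α : Store) : Cond → Prop
  | lt e e' => e.eval α < e'.eval α
  | eq e e' => e.eval α = e'.eval α
  | rlt e e' => e.eval c α < e'.eval c α

def Ok (p q B : ℕ) (α : Store) : Cond → Prop
  | lt e e' => e.Ok q B α ∧ e'.Ok q B α
  | eq e e' => e.Ok q B α ∧ e'.Ok q B α
  | rlt e e' => e.Ok p q B α ∧ e'.Ok p q B α

/-- The cost of evaluating both sides and performing the test. -/
def cost : Cond → ℕ
  | lt e e' => e.cost + e'.cost + 1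
  | eq e e' => e.cost + e'.cost + 1
  | rlt e e' => e.cost + e'.cost + 1

def code : Cond → Prog
  | lt e e' => .seq (e.code 21) (e'.code 22)
  | eq e e' => .seq (e.code 21) (e'.code 22)
  | rlt e e' => .seq (e.code 21) (e'.code 22)

def test : Cond → Test
  | lt _ _ => .wordLt 21 22
  | eq _ _ => .wordEq 21 22
  | rlt _ _ => .realLt 21 22

lemma exec (hS : 10 * (q + 1) ≤ S) (hB : 10 * (q + 1) ≤ B) {α : Store} (b : Cond)
    (ok : b.Ok p q B α) {σ : State} (h : Rel q B α σ) :
    ∃ t τ, Exec c S B b.code σ t τ ∧ b.cost = t + 1 ∧ Rel q B α τ ∧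
      (b.test.Holds τ ↔ b.Holds c α) := by
  cases b with
  | lt e e' | eq e e' =>
    obtain ⟨τ, h1, h2, h3⟩ := e.exec (c := c) hS hB ok.1 (t := 21) le_rfl h
    obtain ⟨υ, h4, h5, h6⟩ := e'.exec (c := c) hS hB ok.2 (t := 22) (by omega) h2.rel
    refine ⟨_, _, Exec.seq h1 h4, rfl, h5.rel, ?_⟩
    simp only [test, Test.Holds, Holds]
    rw [h6, h5.word 21 (by omega), h3]
  | rlt e e' =>
    obtain ⟨τ, h1, h2, h3⟩ := e.exec (c := c) hS hB ok.1 (t := 21) le_rfl h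
    obtain ⟨υ, h4, h5, h6⟩ := e'.exec (c := c) hS hB ok.2 (t := 22) (by omega) h2.rel
    refine ⟨_, _, Exec.seq h1 h4, rfl, h5.rel, ?_⟩
    simp only [test, Test.Holds, Holds]
    rw [h6, h5.real 21 (by omega), h3]

end Cond

/-! ### Statements and program logic with a clock. -/

/-- `x := e` -/
def Prog.setWord (x : WVar) (e : WExp) : Prog :=
  .seq (e.code 21) (.seq (.wordConst 22 0) (.wordOp .add x.idx 21 22))

/-- `x := e` -/
def Prog.setReal (x : RVar) (e : RExp) : Prog :=
  .seq (e.code 21) (.seq (.seq (.wordConst 22 0) (.realOfWord 22 22)) (.realOp .add x.idx 21 22))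

/-- `a[e] := e'` -/
def Prog.putWord (a : WArr) (e e' : WExp) : Prog :=
  .seq (.seq (e.code 21) (e'.code 22)) (.seq (.wordConst 23 a.idx)
      (.seq (.wordOp .mul 23 23 20) (.seq (.wordOp .add 21 23 21) (.wordStore 21 22))))

/-- `a[e] := e'` -/
def Prog.putReal (a : RArr) (e : WExp) (e' : RExp) : Prog :=
  .seq (.seq (e.code 21) (e'.code 22)) (.seq (.wordConst 23 a.idx)
      (.seq (.wordOp .mul 23 23 20) (.seq (.wordOp .add 21 23 21) (.realStore 21 22))))

def Prog.ite (b : Cond) (P Q : Prog) : Prog := .seq b.code (.branch b.test P Q)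

def Prog.whileLoop (b : Cond) (P : Prog) : Prog := .seq b.code (.loop b.test (.seq P b.code))

/-- `P` is repeated with `x = 0, 1, …` as long as `x < e`. -/
def Prog.forLoop (x : WVar) (e : WExp) (P : Prog) : Prog :=
  .seq (.setWord x (.lit 0))
    (.whileLoop (.lt (.var x) e) (.seq P (.setWord x (.add (.var x) (.lit 1)))))

/-- If the machine is large enough, then `P` started in `α` halts in a store with property `Q`;
the clock shows the time taken. -/
def Runs (c : Fin p → Fin q → ℝ) (S B : ℕ) (P : Prog) (α : Store) (Q : Store → Prop) : Prop :=
  10 * (q + 1) ≤ S → 10 * (q + 1) ≤ B → ∀ σ, Rel q B α σ →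
    ∃ t τ β, Exec c S B P σ t τ ∧ Rel q B β τ ∧ β.time = α.time + t ∧ Q β

namespace Runs

variable {P P' : Prog} {α : Store} {Q Q' : Store → Prop}

lemma mono (h : Runs c S B P α Q) (hQ : ∀ β, Q β → Q' β) : Runs c S B P α Q' := by
  intro hS hB σ hσ
  obtain ⟨t, τ, β, h1, h2, h3, h4⟩ := h hS hB σ hσ
  exact ⟨t, τ, β, h1, h2, h3, hQ β h4⟩

lemma seq (h : Runs c S B P α fun β => Runs c S B P' β Q) : Runs c S B (.seq P P') α Q := by
  intro hS hB σ hσ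
  obtain ⟨t, τ, β, h1, h2, h3, h4⟩ := h hS hB σ hσ
  obtain ⟨t', υ, γ, h5, h6, h7, h8⟩ := h4 hS hB τ h2
  exact ⟨_, υ, γ, h1.seq h5, h6, by omega, h8⟩

lemma skip (h : Q α) : Runs c S B .skip α Q := fun _ _ σ hσ => ⟨0, σ, α, .skip σ, hσ, rfl, h⟩

lemma setWord {x : WVar} {e : WExp} (ok : e.Ok q B α)
    (h : Q ((α.setWord x (e.eval α)).tick (e.cost + 2))) : Runs c S B (.setWord x e) α Q := by
  intro hS hB σ hσ
  obtain ⟨τ, h1, h2, h3⟩ := e.exec (c := c) hS hB ok (t := 21) le_rfl hσ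
  have hlt : e.eval α < B := h3 ▸ h2.rel.reg_lt _
  refine ⟨_, _, _, h1.seq (Exec.seq (Exec.wordConst τ 22 0 (by omega))
    (Exec.wordOp _ .add _ 21 22 (e.eval α) ?_ hlt)),
    (((h2.rel.setTemp (t := 22) (by omega) (by omega)).setWord x hlt).tick _), ?_, h⟩
  · simp [WordOp.eval, State.setWordReg, h3]
  · simp

lemma setReal {x : RVar} {e : RExp} (ok : e.Ok p q B α)
    (h : Q ((α.setReal x (e.eval c α)).tick (e.cost + 3))) : Runs c S B (.setReal x e) α Q := by
  intro hS hB σ hσ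
  obtain ⟨τ, h1, h2, h3⟩ := e.exec (c := c) hS hB ok (t := 21) le_rfl hσ
  obtain ⟨υ, h4, h5, h6⟩ := exec_zero (c := c) (S := S) hB (t := 22) (by omega) h2.rel
  refine ⟨_, _, _, h1.seq (h4.seq (Exec.realOp _ .add _ 21 22 (e.eval c α) ?_)),
    ((h5.rel.setReal x _).tick _), ?_, h⟩
  · simp [RealOp.eval, h6, h5.real 21 (by omega), h3]
  · simp

lemma putWord {a : WArr} {e e' : WExp} (ok : e.Ok q B α) (ok' : e'.Ok q B α)
    (hi : e.eval α < 2 * q + 2)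
    (h : Q ((α.putWord a (e.eval α) (e'.eval α)).tick (e.cost + e'.cost + 4))) :
    Runs c S B (.putWord a e e') α Q := by
  intro hS hB σ hσ
  obtain ⟨τ, h1, h2, h3⟩ := e.exec (c := c) hS hB ok (t := 21) le_rfl hσ
  obtain ⟨υ, h4, h5, h6⟩ := e'.exec (c := c) hS hB ok' (t := 22) (by omega) h2.rel
  obtain ⟨ρ, h7, h8, h9, h10, h11, h12, h13⟩ := exec_address (c := c) (S := S) hB h5.rel
    (t := 21) (s := 23) le_rfl (by omega) a.idx_lt hi (by rw [h5.word 21 (by omega), h3])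
  have h14 : ρ.wordReg 22 = e'.eval α := by rw [h10 22 (by omega) (by omega), h6]
  refine ⟨_, _, _, (h1.seq h4).seq (h7 _ _ _ (Exec.wordStore ρ 21 22 ?_)), ?_, ?_, h⟩
  · rw [h9]; exact (address_lt a.idx_lt hi).trans_le hS
  · rw [h9, h14]; exact (h8.putWord a hi (h14 ▸ h8.reg_lt _)).tick _
  · simp

lemma putReal {a : RArr} {e : WExp} {e' : RExp} (ok : e.Ok q B α) (ok' : e'.Ok p q B α)
    (hi : e.eval α < 2 * q + 2)
    (h : Q ((α.putReal a (e.eval α) (e'.eval c α)).tick (e.cost + e'.cost + 4))) :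
    Runs c S B (.putReal a e e') α Q := by
  intro hS hB σ hσ
  obtain ⟨τ, h1, h2, h3⟩ := e.exec (c := c) hS hB ok (t := 21) le_rfl hσ
  obtain ⟨υ, h4, h5, h6⟩ := e'.exec (c := c) hS hB ok' (t := 22) (by omega) h2.rel
  obtain ⟨ρ, h7, h8, h9, h10, h11, h12, h13⟩ := exec_address (c := c) (S := S) hB h5.rel
    (t := 21) (s := 23) le_rfl (by omega) a.idx_lt hi (by rw [h5.word 21 (by omega), h3])
  have h14 : ρ.realReg 22 = e'.eval c α := by rw [h11, h6]
  refine ⟨_, _, _, (h1.seq h4).seq (h7 _ _ _ (Exec.realStore ρ 21 22 ?_)), ?_, ?_, h⟩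
  · rw [h9]; exact (address_lt a.idx_lt hi).trans_le hS
  · rw [h9, h14]; exact (h8.putReal a _ hi).tick _
  · simp

lemma ite {b : Cond} (ok : b.Ok p q B α)
    (h : b.Holds c α → Runs c S B P (α.tick b.cost) Q)
    (h' : ¬ b.Holds c α → Runs c S B P' (α.tick b.cost) Q) : Runs c S B (.ite b P P') α Q := by
  intro hS hB σ hσ
  obtain ⟨t, τ, h1, h2, h3, h4⟩ := b.exec hS hB ok hσ
  by_cases hb : b.Holds c α
  · obtain ⟨t', υ, γ, h5, h6, h7, h8⟩ := h hb hS hB τ (h3.tick _)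
    exact ⟨_, υ, γ, h1.seq (.branch_true (h4.2 hb) h5), h6, by simp at h7; omega, h8⟩
  · obtain ⟨t', υ, γ, h5, h6, h7, h8⟩ := h' hb hS hB τ (h3.tick _)
    exact ⟨_, υ, γ, h1.seq (.branch_false (fun hh => hb (h4.1 hh)) h5), h6,
      by simp at h7; omega, h8⟩

/-- The number in the invariant is a variant: it must decrease in every round, so termination and
correctness are proved together. -/
lemma whileLoop {b : Cond} (Inv : ℕ → Store → Prop)
    (ok : ∀ m β, Inv m β → b.Ok p q B β)
    (step : ∀ m β, Inv m β → b.Holds c β →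
      Runs c S B P (β.tick b.cost) fun γ => ∃ m' < m, Inv m' γ)
    (last : ∀ m β, Inv m β → ¬ b.Holds c β → Q (β.tick b.cost))
    {m : ℕ} (h : Inv m α) : Runs c S B (.whileLoop b P) α Q := by
  intro hS hB
  -- At this point both sides of the condition are already evaluated on the machine but not yet
  -- charged to the clock of `β`. Their `b.cost - 1` steps account for the discrepancy in the time
  -- equation.
  have key : ∀ m β, Inv m β → ∀ τ, Rel q B β τ → (b.test.Holds τ ↔ b.Holds c β) →
      ∃ t υ γ, Exec c S B (.loop b.test (.seq P b.code)) τ t υ ∧ Rel q B γ υ ∧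
        γ.time + 1 = β.time + t + b.cost ∧ Q γ := by
    intro m
    induction m using Nat.strong_induction_on with
    | _ m ih =>
      intro β hβ τ hτ hb
      by_cases hh : b.Holds c β
      · obtain ⟨t, υ, γ, h1, h2, h3, m', hm', h4⟩ := step m β hβ hh hS hB τ (hτ.tick _)
        obtain ⟨t', υ', h5, h6, h7, h8⟩ := b.exec hS hB (ok m' γ h4) h2
        obtain ⟨t'', υ'', δ, h9, h10, h11, h12⟩ := ih m' hm' γ h4 υ' h7 h8
        refine ⟨_, υ'', δ, .loop_true (hb.2 hh) (h1.seq h5) h9, h10, ?_, h12⟩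
        simp at h3; omega
      · exact ⟨1, τ, _, .loop_false (fun h' => hh (hb.1 h')), hτ.tick _, by simp; omega,
          last m β hβ hh⟩
  intro σ hσ
  obtain ⟨t, τ, h1, h2, h3, h4⟩ := b.exec hS hB (ok m α h) hσ
  obtain ⟨t', υ, γ, h5, h6, h7, h8⟩ := key m α h τ h3 h4
  exact ⟨_, υ, γ, h1.seq h5, h6, by omega, h8⟩

/-- The clock increments are those of `x := 0` (3), of the test `x < e` (`e.cost + 3`) and of `x :=
x + 1` (6). The variant of the underlying loop is the number of rounds left. -/
lemma forLoop {x : WVar} {e : WExp} (N : ℕ) (Inv : ℕ → Store → Prop)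
    (hB : 10 * (q + 1) ≤ B → N < B)
    (bound : ∀ m β, Inv m β → e.Ok q B β ∧ e.eval β = N)
    (counter : ∀ m β, Inv m β → β.word x = m)
    (first : Inv 0 ((α.setWord x 0).tick 3))
    (step : ∀ m β, m < N → Inv m β → Runs c S B P (β.tick (e.cost + 3)) fun γ =>
      γ.word x = m ∧ Inv (m + 1) ((γ.setWord x (m + 1)).tick 6))
    (last : ∀ β, Inv N β → Q (β.tick (e.cost + 3))) : Runs c S B (.forLoop x e P) α Q := by
  intro hS hB'
  have hN := hB hB'
  have hc : (Cond.lt (.var x) e).cost = e.cost + 3 := by simp [Cond.cost, WExp.cost]; omega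
  revert hS hB'
  refine seq (setWord (by simp [WExp.Ok]; omega) ?_)
  refine Runs.whileLoop (fun m β => ∃ m', m + m' = N ∧ Inv m' β) ?_ ?_ ?_ (m := N) ⟨0, by omega, first⟩
  · rintro m β ⟨m', -, h⟩
    exact ⟨trivial, (bound m' β h).1⟩
  · rintro m β ⟨m', hm, h⟩ hh
    simp only [Cond.Holds, WExp.eval, counter m' β h, (bound m' β h).2] at hh
    rw [hc]
    refine seq ((step m' β hh h).mono ?_)
    rintro γ ⟨h1, h2⟩
    refine setWord ⟨trivial, ?_, ?_⟩ ⟨m - 1, by omega, m' + 1, by omega, ?_⟩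
    · simp [WExp.Ok]; omega
    · simp [WExp.eval, h1]; omega
    · simpa [WExp.eval, h1, WExp.cost] using h2
  · rintro m β ⟨m', hm, h⟩ hh
    simp only [Cond.Holds, WExp.eval, counter m' β h, (bound m' β h).2] at hh
    rw [hc]
    obtain rfl : m' = N := by omega
    exact last β h

end Runs

attribute [simp] WExp.eval WExp.Ok WExp.cost RExp.eval RExp.Ok RExp.cost Cond.Holds Cond.Ok Cond.cost

/-! ## The cheapest free right vertices -/

/-- Apart from vertices `v` with `taken v ≠ 0`, `e` is the right vertex in the `b`-th block of `p`
consecutive vertices to which the edge from `u` is cheapest; it is `q` if there is none.  Only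
vertices below `l` are considered. -/
structure IsBlockMin (c : Fin p → Fin q → ℝ) (taken : ℕ → ℕ) (u b l e : ℕ) : Prop where
  le : e ≤ q
  free : e < q → taken e = 0
  block : e < q → e / p = b
  min : ∀ v < q, v < l → v / p = b → taken v = 0 → e < q ∧ extendWeight c u e ≤ extendWeight c u v

/-- Word variables `p`, `q`, `nb` hold `|U|`, `|V|` and the number of blocks. -/
structure HasSizes (p q : ℕ) (α : Store) : Prop where
  left : α.word .p = p
  right : α.word .q = q
  blocks : α.word .nb = q / p + 1

/-- Store the cheapest free right vertex in block `b` for the left vertex `u`. -/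
def findBlockMin : Prog :=
  .seq (.setWord .best (.var .q)) (.seq (.forLoop .j (.var .p)
    (.seq (.setWord .v (.add (.mul (.var .b) (.var .p)) (.var .j)))
    (.ite (.lt (.var .v) (.var .q))
      (.ite (.eq (.get .taken (.var .v)) (.lit 0))
        (.ite (.eq (.var .best) (.var .q))
          (.setWord .best (.var .v))
          (.ite (.rlt (.weight (.var .u) (.var .v)) (.weight (.var .u) (.var .best)))
            (.setWord .best (.var .v)) .skip)) .skip) .skip)))
  (.putWord .blk (.add (.mul (.var .u) (.var .nb)) (.var .b)) (.var .best)))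

/-- The table has $p(\lfloor q/p\rfloor+1)\le q+p\le 2q$ entries. This is what fixes the length of
the arrays. -/
lemma block_address_lt (hpq : p ≤ q) {u b : ℕ} (hu : u < p) (hb : b < q / p + 1) :
    u * (q / p + 1) + b < 2 * q + 2 := by
  have h1 : u * (q / p + 1) ≤ (p - 1) * (q / p + 1) := Nat.mul_le_mul_right _ (by omega)
  have h2 : p * (q / p) ≤ q := Nat.mul_div_le q p
  have h3 : (p - 1) * (q / p + 1) + (q / p + 1) = p * (q / p) + p := by
    obtain ⟨m, rfl⟩ := Nat.exists_eq_succ_of_ne_zero (show p ≠ 0 by omega)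
    simp; ring
  omega

lemma block_start_le {b : ℕ} (hb : b < q / p + 1) : b * p ≤ q :=
  (Nat.mul_le_mul_right _ (Nat.lt_succ_iff.1 hb)).trans (Nat.div_mul_le_self q p)

lemma IsBlockMin.extend {taken : ℕ → ℕ} {u b l e : ℕ} (h : IsBlockMin c taken u b l e)
    (hl : l < q → taken l = 0 → l / p = b → e < q ∧ extendWeight c u e ≤ extendWeight c u l) :
    IsBlockMin c taken u b (l + 1) e where
  le := h.le
  free := h.free
  block := h.block
  min v hv hvl hb ht := by
    rcases Nat.lt_succ_iff_lt_or_eq.1 hvl with h' | rfl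
    · exact h.min v hv h' hb ht
    · exact hl hv ht hb

lemma IsBlockMin.replace {taken : ℕ → ℕ} {u b l e : ℕ} (h : IsBlockMin c taken u b l e)
    (hl : l < q) (ht : taken l = 0) (hb : l / p = b)
    (he : e = q ∨ extendWeight c u l < extendWeight c u e) :
    IsBlockMin c taken u b (l + 1) l where
  le := hl.le
  free _ := ht
  block _ := hb
  min v hv hvl hb ht := by
    rcases Nat.lt_succ_iff_lt_or_eq.1 hvl with h' | rfl
    · obtain ⟨h1, h2⟩ := h.min v hv h' hb ht
      rcases he with he | he
      · omega
      · exact ⟨hl, he.le.trans h2⟩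
    · exact ⟨hl, le_rfl⟩

lemma runs_findBlockMin (hB : 10 * (q + 1) ≤ B) (hpq : p ≤ q) {α : Store} (hα : HasSizes p q α)
    {u b : ℕ} (hu : u < p) (hb : b < q / p + 1) (hαu : α.word .u = u) (hαb : α.word .b = b) :
    Runs c S B findBlockMin α fun β =>
      (∃ e, IsBlockMin c (α.warr .taken) u b q e ∧ β.warr = Function.update α.warr .blk
        (Function.update (α.warr .blk) (u * (q / p + 1) + b) e)) ∧ β.rarr = α.rarr ∧
      (∀ x, x ≠ .j → x ≠ .v → x ≠ .best → β.word x = α.word x) ∧ β.time ≤ α.time + 80 * (p + 1) := by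
  have h1 := block_start_le hb
  refine .seq (.setWord trivial (.seq (.forLoop p (fun m β =>
    IsBlockMin c (α.warr .taken) u b (b * p + m) (β.word .best) ∧ β.word .j = m ∧
    β.warr = α.warr ∧ β.rarr = α.rarr ∧ (∀ x, x ≠ .j → x ≠ .v → x ≠ .best → β.word x = α.word x) ∧
    β.time ≤ α.time + 10 + 70 * m) (fun _ => by omega) ?_ ?_ ?_ ?_ ?_)))
  · rintro m β ⟨-, -, -, -, h, -⟩
    exact ⟨trivial, by simp [h, hα.left]⟩
  · rintro m β h; exact h.2.1
  · refine ⟨⟨?_, ?_, ?_, ?_⟩, ?_, ?_, ?_, ?_, ?_⟩ <;> simp [hα.right]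
    -- The scan starts at `b * p`; smaller vertices lie in earlier blocks, so there is nothing to
    -- check.
    · intro v hv h2 h3
      have := Nat.lt_mul_of_div_lt (show v / p < b + 0 + 1 by omega) (by omega)
      have h4 := Nat.div_mul_le_self v p
      rw [h3] at h4
      omega
    · intro x hx1 hx2 hx3
      simp [hx1, hx3]
  · rintro m β hm ⟨hmin, hj, hw, hr, hx, ht⟩
    have e1 : β.word .b = b := by simp [hx, hαb]
    have e2 : β.word .p = p := by simp [hx, hα.left]
    have e3 : β.word .q = q := by simp [hx, hα.right]
    have e4 : β.word .u = u := by simp [hx, hαu]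
    have hdiv : (b * p + m) / p = b := by
      rw [mul_comm, Nat.mul_add_div (by omega), Nat.div_eq_of_lt hm]; rfl
    have hle := hmin.le
    refine .seq (.setWord (by simp [e1, e2, hj]; omega) ?_)
    refine .ite ⟨trivial, trivial⟩ (fun hv => ?_) (fun hv => ?_) <;> simp [e1, e2, e3, hj] at hv
    · refine .ite (by simp [e1, e2, hj]; omega) (fun h => ?_) (fun h => ?_) <;>
        simp [e1, e2, hj, hw] at h
      · refine .ite ⟨trivial, trivial⟩ (fun h' => ?_) (fun h' => ?_) <;> simp [e3] at h'
        · refine .setWord trivial ?_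
          simp [e1, e2, hj, hw, hr]
          exact ⟨hmin.replace hv h hdiv (.inl h'), by simp +contextual [hx], by omega⟩
        · refine .ite ?_ (fun h'' => ?_) (fun h'' => ?_)
          · simp [e1, e2, e4, hj]; omega
          · refine .setWord trivial ?_
            simp [e1, e2, e4, hj] at h''
            simp [e1, e2, hj, hw, hr]
            exact ⟨hmin.replace hv h hdiv (.inr h''), by simp +contextual [hx], by omega⟩
          · refine .skip ?_
            simp [e1, e2, e4, hj] at h''
            simp [e1, e2, hj, hw, hr]
            exact ⟨hmin.extend fun _ _ _ => ⟨by omega, h''⟩, by simp +contextual [hx], by omega⟩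
      · refine .skip ?_
        simp [hj, hw, hr]
        exact ⟨hmin.extend fun _ h2 => absurd h2 h, by simp +contextual [hx], by omega⟩
    · refine .skip ?_
      simp [hj, hw, hr]
      exact ⟨hmin.extend fun h2 => absurd h2 (by omega), by simp +contextual [hx], by omega⟩
  · rintro β ⟨hmin, hj, hw, hr, hx, ht⟩
    have e1 : β.word .b = b := by simp [hx, hαb]
    have e4 : β.word .u = u := by simp [hx, hαu]
    have e5 : β.word .nb = q / p + 1 := by simp [hx, hα.blocks]
    have h2 := block_address_lt hpq hu hb
    refine .putWord (by simp [e1, e4, e5]; omega) trivial (by simpa [e1, e4, e5] using h2) ?_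
    simp [e1, e4, e5, hw, hr]
    refine ⟨⟨_, ⟨hmin.le, hmin.free, hmin.block, fun v hv _ hb => hmin.min v hv ?_ hb⟩, rfl⟩,
      by simp +contextual [hx], by omega⟩
    -- Block `b` ends before `b * p + p`, so the scan has seen all of it.
    have := Nat.lt_mul_of_div_lt (show v / p < b + 1 by omega) (by omega)
    rw [add_mul] at this
    omega

/-- Store the cheapest free right vertices in block `b` for all left vertices. -/
def findBlockMins : Prog := .forLoop .u (.var .p) findBlockMin

lemma HasSizes.of_eq {α β : Store} (hα : HasSizes p q α) (h1 : β.word .p = α.word .p)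
    (h2 : β.word .q = α.word .q) (h3 : β.word .nb = α.word .nb) : HasSizes p q β :=
  ⟨h1.trans hα.left, h2.trans hα.right, h3.trans hα.blocks⟩

lemma runs_findBlockMins (hB : 10 * (q + 1) ≤ B) (hpq : p ≤ q) {α : Store} (hα : HasSizes p q α)
    {b : ℕ} (hb : b < q / p + 1) (hαb : α.word .b = b) :
    Runs c S B findBlockMins α fun β =>
      (∀ u < p, IsBlockMin c (α.warr .taken) u b q (β.warr .blk (u * (q / p + 1) + b))) ∧
      (∀ u b', b' < q / p + 1 → b' ≠ b →
        β.warr .blk (u * (q / p + 1) + b') = α.warr .blk (u * (q / p + 1) + b')) ∧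
      (∀ a, a ≠ .blk → β.warr a = α.warr a) ∧ β.rarr = α.rarr ∧
      (∀ x, x ≠ .u → x ≠ .j → x ≠ .v → x ≠ .best → β.word x = α.word x) ∧
      β.time ≤ α.time + 100 * (p + 1) * (p + 1) := by
  refine .forLoop p (fun m β =>
      (∀ u < m, IsBlockMin c (α.warr .taken) u b q (β.warr .blk (u * (q / p + 1) + b))) ∧
      (∀ u b', b' < q / p + 1 → b' ≠ b →
        β.warr .blk (u * (q / p + 1) + b') = α.warr .blk (u * (q / p + 1) + b')) ∧
      (∀ a, a ≠ .blk → β.warr a = α.warr a) ∧ β.rarr = α.rarr ∧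
      (∀ x, x ≠ .u → x ≠ .j → x ≠ .v → x ≠ .best → β.word x = α.word x) ∧ β.word .u = m ∧
      β.time ≤ α.time + 3 + 95 * (p + 1) * m) (fun _ => by omega) ?_ ?_ ?_ ?_ ?_
  · rintro m β ⟨-, -, -, -, h, -⟩
    exact ⟨trivial, by simp [h, hα.left]⟩
  · rintro m β h; exact h.2.2.2.2.2.1
  · simp +contextual
  · rintro m β hm ⟨hmin, hb', hw, hr, hx, hu, ht⟩
    refine (runs_findBlockMin (u := m) (b := b) hB hpq (hα.of_eq ?_ ?_ ?_) hm hb ?_ ?_).mono ?_ <;>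
      simp [hx, hαb, hu, hw, -Order.lt_add_one_iff]
    intro γ e he hγw hγr hγx hγt
    simp [hγx, hu, hγw, hγr, hr, -Order.lt_add_one_iff]
    refine ⟨fun u hum => ?_, fun u b' hb1 hb2 => ?_, by simp +contextual [hw],
      by simp +contextual [hx, hγx], by nlinarith⟩
    · by_cases h : u = m
      · subst h; simpa using he
      · have : u * (q / p + 1) + b ≠ m * (q / p + 1) + b := fun h' => h (address_inj hb hb h').1
        simp only [Function.update_of_ne this]
        exact hmin u (by omega)
    · have : u * (q / p + 1) + b' ≠ m * (q / p + 1) + b := fun h' => hb2 (address_inj hb1 hb h').2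
      simp only [Function.update_of_ne this, hb' u b' hb1 hb2]
  · rintro β ⟨hmin, hb', hw, hr, hx, hu, ht⟩
    simp [hr, -Order.lt_add_one_iff]
    exact ⟨hmin, hb', hw, by simpa using hx, by nlinarith⟩

/-- Store the cheapest free right vertices in all blocks for all left vertices. -/
def findAllBlockMins : Prog := .forLoop .b (.var .nb) findBlockMins

/-- For every left vertex, the array `blk` holds the cheapest free right vertex in every block. -/
def BlocksCorrect (c : Fin p → Fin q → ℝ) (α : Store) : Prop :=
  ∀ u < p, ∀ b < q / p + 1, IsBlockMin c (α.warr .taken) u b q (α.warr .blk (u * (q / p + 1) + b))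

lemma runs_findAllBlockMins (hB : 10 * (q + 1) ≤ B) (hpq : p ≤ q) {α : Store}
    (hα : HasSizes p q α) :
    Runs c S B findAllBlockMins α fun β => BlocksCorrect c β ∧
      (∀ a, a ≠ .blk → β.warr a = α.warr a) ∧ β.rarr = α.rarr ∧
      (∀ x, x ≠ .b → x ≠ .u → x ≠ .j → x ≠ .v → x ≠ .best → β.word x = α.word x) ∧
      β.time ≤ α.time + 10 + 120 * (p + 1) * (p + 1) * (q / p + 1) := by
  have hqp := Nat.div_le_self q p
  refine .forLoop (q / p + 1) (fun m β =>
      (∀ u < p, ∀ b < m,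
        IsBlockMin c (α.warr .taken) u b q (β.warr .blk (u * (q / p + 1) + b))) ∧
      (∀ a, a ≠ .blk → β.warr a = α.warr a) ∧ β.rarr = α.rarr ∧
      (∀ x, x ≠ .b → x ≠ .u → x ≠ .j → x ≠ .v → x ≠ .best → β.word x = α.word x) ∧ β.word .b = m ∧
      β.time ≤ α.time + 3 + 120 * (p + 1) * (p + 1) * m) (fun _ => by omega) ?_ ?_ ?_ ?_ ?_
  · rintro m β ⟨-, -, -, h, -⟩
    exact ⟨trivial, by simp [h, hα.blocks]⟩
  · rintro m β h; exact h.2.2.2.2.1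
  · simp +contextual
  · rintro m β hm ⟨hmin, hw, hr, hx, hb, ht⟩
    refine (runs_findBlockMins (b := m) hB hpq (hα.of_eq ?_ ?_ ?_) hm ?_).mono ?_ <;>
      simp [hx, hb, hw, -Order.lt_add_one_iff]
    intro γ he hγb hγw hγr hγx hγt
    simp [hγx, hb, hγr, hr, -Order.lt_add_one_iff]
    refine ⟨fun u hu b' hb' => ?_, fun a ha => by rw [hγw a ha, hw a ha],
      by simp +contextual [hx, hγx], by linarith [Nat.mul_pos p.succ_pos p.succ_pos]⟩
    rcases Nat.lt_succ_iff_lt_or_eq.1 hb' with h | rfl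
    · rw [hγb u b' (by omega) (by omega)]; exact hmin u hu b' h
    · exact he u hu
  · rintro β ⟨hmin, hw, hr, hx, hb, ht⟩
    simp [hr, BlocksCorrect, hw, -Order.lt_add_one_iff]
    exact ⟨hmin, hw, by simpa using hx, by omega⟩

/-! ## Shortest paths -/

/-- `c(u, v) + price(v)` -/
def pricedWeight (u v : WExp) : RExp := .add (.weight u v) (.get .price v)

/-- Start the search at the left vertex `k`: `dist[i]` is the length of the path to the left vertex
`i` found so far, and `pred[i]` is the left vertex before `i` on it. -/
def startSearch : Prog :=
  -- The root is unmatched and is reached by the empty path, of length `0`.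
  .seq (.putReal .off (.var .k) .zero) (.forLoop .i (.var .k)
    (.seq (.putReal .dist (.var .i) (pricedWeight (.var .k) (.get .f (.var .i))))
    (.seq (.putWord .pred (.var .i) (.var .k)) (.putWord .rank (.var .i) (.lit 0)))))

/-- Find the left vertex of smallest distance among those that are not scanned. -/
def findNearest : Prog :=
  .seq (.setWord .best (.var .k)) (.forLoop .i (.var .k)
    (.ite (.eq (.get .rank (.var .i)) (.lit 0))
      (.ite (.eq (.var .best) (.var .k)) (.setWord .best (.var .i))
        (.ite (.rlt (.get .dist (.var .i)) (.get .dist (.var .best)))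
          (.setWord .best (.var .i)) .skip)) .skip))

/-- Scan the left vertex `best`. -/
def scanNearest : Prog :=
  .seq (.putWord .rank (.var .best) (.add (.var .n) (.lit 1)))
    (.seq (.putReal .off (.var .best)
      -- The path returns from the right vertex along the matching edge, whose priced weight is
      -- subtracted.
      (.sub (.get .dist (.var .best)) (pricedWeight (.var .best) (.get .f (.var .best)))))
    (.forLoop .i (.var .k) (.ite (.eq (.get .rank (.var .i)) (.lit 0))
      (.seq (.setReal .cand (.add (.get .off (.var .best))
        (pricedWeight (.var .best) (.get .f (.var .i)))))
      (.ite (.rlt (.var .cand) (.get .dist (.var .i)))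
        (.seq (.putReal .dist (.var .i) (.var .cand)) (.putWord .pred (.var .i) (.var .best)))
        .skip)) .skip)))

def search : Prog := .seq startSearch (.forLoop .n (.var .k) (.seq findNearest scanNearest))

attribute [simp] pricedWeight

/-- The weight of the edge from `u` to `v` plus the price of `v`. -/
noncomputable def priced (c : Fin p → Fin q → ℝ) (price : ℕ → ℝ) (u v : ℕ) : ℝ :=
  extendWeight c u v + price v

lemma runs_startSearch (hB : 10 * (q + 1) ≤ B) (hpq : p ≤ q) {α : Store} {k : ℕ} (hk : k < p)
    (hαk : α.word .k = k) (hf : ∀ i < k, α.warr .f i < q) :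
    Runs c S B startSearch α fun β =>
      (∀ i < k, β.rarr .dist i = priced c (α.rarr .price) k (α.warr .f i) ∧
        β.warr .pred i = k ∧ β.warr .rank i = 0) ∧ β.rarr .off k = 0 ∧
      (∀ a, a ≠ .pred → a ≠ .rank → β.warr a = α.warr a) ∧ β.rarr .price = α.rarr .price ∧
      (∀ x, x ≠ .i → β.word x = α.word x) ∧ β.time ≤ α.time + 70 * (k + 1) := by
  refine .seq (.putReal trivial trivial (by simp [hαk]; omega) (.forLoop k (fun m β =>
      (∀ i < m, β.rarr .dist i = priced c (α.rarr .price) k (α.warr .f i) ∧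
        β.warr .pred i = k ∧ β.warr .rank i = 0) ∧ β.rarr .off k = 0 ∧
      (∀ a, a ≠ .pred → a ≠ .rank → β.warr a = α.warr a) ∧ β.rarr .price = α.rarr .price ∧
      (∀ x, x ≠ .i → β.word x = α.word x) ∧ β.word .i = m ∧
      β.time ≤ α.time + 20 + 70 * m) (fun _ => by omega) ?_ ?_ ?_ ?_ ?_))
  · rintro m β ⟨-, -, -, -, h, -⟩
    exact ⟨trivial, by simp [h, hαk]⟩
  · rintro m β h; exact h.2.2.2.2.2.1
  · simp +contextual [hαk]
  · rintro m β hm ⟨h, ho, hw, hr, hx, hi, ht⟩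
    have hfm := hf m hm
    refine .seq (.putReal trivial ?_ ?_ (.seq (.putWord trivial trivial ?_
      (.putWord trivial ?_ ?_ ?_)))) <;> simp [hi, hx, hw, hαk, hr, ho]
    any_goals omega
    refine ⟨fun i hi => ?_, by simp +contextual [hw], by simp +contextual [hx], by omega⟩
    rcases hi.lt_or_eq with h' | rfl
    · simpa [h'.ne] using h i h'
    · simp [priced]
  · rintro β ⟨h, ho, hw, hr, hx, hi, ht⟩
    simp [hr]
    exact ⟨h, ho, hw, hx, by omega⟩

/-- Among the left vertices `j < l` with `rank j = 0`, the vertex `e` has the smallest distance; it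
is `k` if there are none. -/
structure IsNearest (dist : ℕ → ℝ) (rank : ℕ → ℕ) (k l e : ℕ) : Prop where
  le : e ≤ k
  unscanned : e < k → rank e = 0
  min : ∀ j < l, rank j = 0 → e < k ∧ dist e ≤ dist j

lemma IsNearest.extend {dist : ℕ → ℝ} {rank : ℕ → ℕ} {k l e : ℕ} (h : IsNearest dist rank k l e)
    (hl : rank l = 0 → e < k ∧ dist e ≤ dist l) : IsNearest dist rank k (l + 1) e where
  le := h.le
  unscanned := h.unscanned
  min j hj hr := by
    rcases Nat.lt_succ_iff_lt_or_eq.1 hj with h' | rfl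
    · exact h.min j h' hr
    · exact hl hr

lemma IsNearest.replace {dist : ℕ → ℝ} {rank : ℕ → ℕ} {k l e : ℕ} (h : IsNearest dist rank k l e)
    (hl : l < k) (hr : rank l = 0) (he : e = k ∨ dist l < dist e) :
    IsNearest dist rank k (l + 1) l where
  le := hl.le
  unscanned _ := hr
  min j hj hr := by
    rcases Nat.lt_succ_iff_lt_or_eq.1 hj with h' | rfl
    · obtain ⟨h1, h2⟩ := h.min j h' hr
      rcases he with he | he
      · omega
      · exact ⟨hl, he.le.trans h2⟩
    · exact ⟨hl, le_rfl⟩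

lemma runs_findNearest (hB : 10 * (q + 1) ≤ B) (hpq : p ≤ q) {α : Store} {k : ℕ} (hk : k < p)
    (hαk : α.word .k = k) :
    Runs c S B findNearest α fun β =>
      IsNearest (α.rarr .dist) (α.warr .rank) k k (β.word .best) ∧
      β.warr = α.warr ∧ β.rarr = α.rarr ∧ (∀ x, x ≠ .i → x ≠ .best → β.word x = α.word x) ∧
      β.time ≤ α.time + 70 * (k + 1) := by
  refine .seq (.setWord trivial (.forLoop k (fun m β =>
      IsNearest (α.rarr .dist) (α.warr .rank) k m (β.word .best) ∧
      β.warr = α.warr ∧ β.rarr = α.rarr ∧ (∀ x, x ≠ .i → x ≠ .best → β.word x = α.word x) ∧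
      β.word .i = m ∧ β.time ≤ α.time + 20 + 70 * m) (fun _ => by omega) ?_ ?_ ?_ ?_ ?_))
  · rintro m β ⟨-, -, -, h, -⟩
    exact ⟨trivial, by simp [h, hαk]⟩
  · rintro m β h; exact h.2.2.2.2.1
  · simp +contextual [hαk]
    exact ⟨le_rfl, by simp, by simp⟩
  · rintro m β hm ⟨h, hw, hr, hx, hi, ht⟩
    have hle := h.le
    refine .ite (by simp [hi]; omega) (fun h1 => ?_) (fun h1 => ?_) <;> simp [hi, hw] at h1
    · refine .ite ⟨trivial, trivial⟩ (fun h2 => ?_) (fun h2 => ?_) <;> simp [hx, hαk] at h2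
      · refine .setWord trivial ?_
        simp [hi, hw, hr]
        exact ⟨h.replace hm h1 (.inl h2), by simp +contextual [hx], by omega⟩
      · refine .ite (by simp [hi]; omega) (fun h3 => ?_) (fun h3 => ?_) <;> simp [hi, hr] at h3
        · refine .setWord trivial ?_
          simp [hi, hw, hr]
          exact ⟨h.replace hm h1 (.inr h3), by simp +contextual [hx], by omega⟩
        · refine .skip ?_
          simp [hi, hw, hr]
          exact ⟨h.extend fun _ => ⟨by omega, h3⟩, by simp +contextual [hx], by omega⟩
    · refine .skip ?_
      simp [hi, hw, hr]
      exact ⟨h.extend fun h' => absurd h' h1, by simp +contextual [hx], by omega⟩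
  · rintro β ⟨h, hw, hr, hx, hi, ht⟩
    simp [hr, hw]
    exact ⟨h, hx, by omega⟩

/-- `dist'` and `pred'` arise from `dist` and `pred` when the vertices below `l` with `rank = 0` are
offered the path via `e` of length `new`. -/
def Relaxed (new : ℕ → ℝ) (rank : ℕ → ℕ) (e l : ℕ) (dist dist' : ℕ → ℝ) (pred pred' : ℕ → ℕ) :
    Prop :=
  ∀ i, (i < l ∧ rank i = 0 ∧ new i < dist i ∧ dist' i = new i ∧ pred' i = e) ∨
    (¬ (i < l ∧ rank i = 0 ∧ new i < dist i) ∧ dist' i = dist i ∧ pred' i = pred i)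

lemma Relaxed.skip {new : ℕ → ℝ} {rank : ℕ → ℕ} {e l : ℕ} {dist dist' : ℕ → ℝ} {pred pred' : ℕ → ℕ}
    (h : Relaxed new rank e l dist dist' pred pred') (hl : rank l ≠ 0 ∨ ¬ new l < dist l) :
    Relaxed new rank e (l + 1) dist dist' pred pred' := by
  intro i
  rcases h i with ⟨h1, h2⟩ | ⟨h1, h2⟩
  · exact .inl ⟨by omega, h2⟩
  · refine .inr ⟨fun ⟨h3, h4, h5⟩ => ?_, h2⟩
    rcases Nat.lt_succ_iff_lt_or_eq.1 h3 with h' | rfl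
    · exact h1 ⟨h', h4, h5⟩
    · tauto

lemma Relaxed.eq {new : ℕ → ℝ} {rank : ℕ → ℕ} {e l : ℕ} {dist dist' : ℕ → ℝ} {pred pred' : ℕ → ℕ}
    (h : Relaxed new rank e l dist dist' pred pred') : dist' l = dist l := by
  rcases h l with h1 | h1
  · omega
  · exact h1.2.1

lemma Relaxed.put {new : ℕ → ℝ} {rank : ℕ → ℕ} {e l : ℕ} {dist dist' : ℕ → ℝ} {pred pred' : ℕ → ℕ}
    (h : Relaxed new rank e l dist dist' pred pred') (hr : rank l = 0) (hl : new l < dist l) :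
    Relaxed new rank e (l + 1) dist (Function.update dist' l (new l)) pred
      (Function.update pred' l e) := by
  intro i
  by_cases hi : i = l
  · subst hi; simp [hr, hl]
  · have : i < l + 1 ↔ i < l := by omega
    simpa [hi, this] using h i

lemma runs_scanNearest (hB : 10 * (q + 1) ≤ B) (hpq : p ≤ q) {α : Store} {k e m : ℕ} (hk : k < p)
    (hαk : α.word .k = k) (hf : ∀ i < k, α.warr .f i < q) (he : e < k) (hαe : α.word .best = e)
    (hm : m < k) (hαm : α.word .n = m) :
    Runs c S B scanNearest α fun β =>
      β.rarr .off = Function.update (α.rarr .off) e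
        (α.rarr .dist e - priced c (α.rarr .price) e (α.warr .f e)) ∧
      β.warr .rank = Function.update (α.warr .rank) e (m + 1) ∧
      Relaxed (fun i => β.rarr .off e + priced c (α.rarr .price) e (α.warr .f i)) (β.warr .rank) e k
        (α.rarr .dist) (β.rarr .dist) (α.warr .pred) (β.warr .pred) ∧
      (∀ a, a ≠ .pred → a ≠ .rank → β.warr a = α.warr a) ∧ β.rarr .price = α.rarr .price ∧
      (∀ x, x ≠ .i → β.word x = α.word x) ∧ β.time ≤ α.time + 100 * (k + 1) := by
  have hfe := hf e he
  refine .seq (.putWord trivial (by simp [hαm]; omega) (by simp [hαe]; omega)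
    (.seq (.putReal trivial (by simp [hαe]; omega) (by simp [hαe]; omega)
    (.forLoop k (fun l β =>
      β.rarr .off = Function.update (α.rarr .off) e
        (α.rarr .dist e - priced c (α.rarr .price) e (α.warr .f e)) ∧
      β.warr .rank = Function.update (α.warr .rank) e (m + 1) ∧
      Relaxed (fun i => β.rarr .off e + priced c (α.rarr .price) e (α.warr .f i)) (β.warr .rank) e l
        (α.rarr .dist) (β.rarr .dist) (α.warr .pred) (β.warr .pred) ∧
      (∀ a, a ≠ .pred → a ≠ .rank → β.warr a = α.warr a) ∧ β.rarr .price = α.rarr .price ∧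
      (∀ x, x ≠ .i → β.word x = α.word x) ∧ β.word .i = l ∧
      β.time ≤ α.time + 80 + 100 * l) (fun _ => by omega) ?_ ?_ ?_ ?_ ?_))))
  · rintro m β ⟨-, -, -, -, -, h, -⟩
    exact ⟨trivial, by simp [h, hαk]⟩
  · rintro m β h; exact h.2.2.2.2.2.2.1
  · simp +contextual [hαe, hαm, priced]
    exact fun i => .inr (by simp)
  · rintro l β hl ⟨ho, hrk, h, hw, hr, hx, hi, ht⟩
    have hfl := hf l hl
    refine .ite (by simp [hi]; omega) (fun h1 => ?_) (fun h1 => ?_) <;> simp [hi] at h1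
    · refine .seq (.setReal (by simp [hi, hx, hαe, hw]; omega) ?_)
      refine .ite (by simp [hi]; omega) (fun h2 => ?_) (fun h2 => ?_) <;>
        simp [hi, hx, hαe, hw, hr, h.eq] at h2
      · refine .seq (.putReal trivial trivial (by simp [hi]; omega)
          (.putWord trivial trivial (by simp [hi]; omega) ?_))
        simp [hi, hx, hαe, hw, hr]
        exact ⟨ho, hrk, h.put h1 h2, by simp +contextual [hw], by simp +contextual [hx],
          by omega⟩
      · refine .skip ?_
        simp [hi, hr]
        exact ⟨ho, hrk, h.skip (.inr (not_lt.2 h2)), hw, by simp +contextual [hx], by omega⟩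
    · refine .skip ?_
      simp [hi, hr]
      exact ⟨ho, hrk, h.skip (.inl h1), hw, by simp +contextual [hx], by omega⟩
  · rintro β ⟨ho, hrk, h, hw, hr, hx, hi, ht⟩
    simp [hr]
    exact ⟨ho, hrk, h, hw, hx, by omega⟩

/-- The state of the search for shortest paths from the left vertex `k`, where `f` is the current
matching of the left vertices below `k` and `w` are the priced weights.  The vertices with
`rank ≠ 0` are scanned, in this order. -/
structure SearchState (w : ℕ → ℕ → ℝ) (f : ℕ → ℕ) (k m : ℕ) (dist off : ℕ → ℝ)
    (pred rank : ℕ → ℕ) : Prop where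
  off_root : off k = 0
  off_eq : ∀ i < k, rank i ≠ 0 → off i = dist i - w i (f i)
  rank_le : ∀ i < k, rank i ≤ m
  card : ((Finset.range k).filter fun i => rank i ≠ 0).card = m
  le_root : ∀ i < k, dist i ≤ off k + w k (f i)
  le : ∀ r < k, rank r ≠ 0 → ∀ i < k, dist i ≤ off r + w r (f i)
  dist_eq : ∀ i < k, dist i = off (pred i) + w (pred i) (f i)
  pred_or : ∀ i < k, pred i = k ∨
    (pred i < k ∧ rank (pred i) ≠ 0 ∧ (rank i ≠ 0 → rank (pred i) < rank i))
  mono : ∀ i < k, rank i ≠ 0 → ∀ j < k, rank j = 0 → dist i ≤ dist j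

lemma SearchState.start {w : ℕ → ℕ → ℝ} {f : ℕ → ℕ} {k : ℕ} {dist off : ℕ → ℝ}
    {pred rank : ℕ → ℕ} (h : ∀ i < k, dist i = w k (f i) ∧ pred i = k ∧ rank i = 0)
    (h0 : off k = 0) : SearchState w f k 0 dist off pred rank where
  off_root := h0
  off_eq i hi hr := absurd (h i hi).2.2 hr
  rank_le i hi := (h i hi).2.2.le
  card := by
    rw [Finset.card_eq_zero, Finset.filter_eq_empty_iff]
    intro i hi
    simpa using (h i (Finset.mem_range.1 hi)).2.2
  le_root i hi := by rw [h0, zero_add, (h i hi).1]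
  le r hr hrr := absurd (h r hr).2.2 hrr
  dist_eq i hi := by rw [(h i hi).2.1, h0, zero_add, (h i hi).1]
  pred_or i hi := .inl (h i hi).2.1
  mono i hi hr := absurd (h i hi).2.2 hr

lemma SearchState.exists_unscanned {w : ℕ → ℕ → ℝ} {f : ℕ → ℕ} {k m : ℕ} {dist off : ℕ → ℝ}
    {pred rank : ℕ → ℕ} (h : SearchState w f k m dist off pred rank) (hm : m < k) :
    ∃ i < k, rank i = 0 := by
  by_contra! h'
  have := h.card
  rw [Finset.filter_true_of_mem fun i hi => h' i (Finset.mem_range.1 hi), Finset.card_range] at this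
  omega

lemma SearchState.all_scanned {w : ℕ → ℕ → ℝ} {f : ℕ → ℕ} {k : ℕ} {dist off : ℕ → ℝ}
    {pred rank : ℕ → ℕ} (h : SearchState w f k k dist off pred rank) : ∀ i < k, rank i ≠ 0 := by
  have h1 := Finset.eq_of_subset_of_card_le (Finset.filter_subset (fun i => rank i ≠ 0)
    (Finset.range k)) (by rw [h.card, Finset.card_range])
  intro i hi
  have := Finset.mem_range.2 hi
  rw [← h1] at this
  exact (Finset.mem_filter.1 this).2

/-- The step of Dijkstra's algorithm. By `hw` the reduced weights `w i (f j) - w i (f i)` are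
nonnegative, so a path through the nearest unscanned vertex `e` never undercuts `dist e`. Labels of
scanned vertices are therefore final, and the order of distances is kept. -/
lemma SearchState.scan {w : ℕ → ℕ → ℝ} {f : ℕ → ℕ} {k m e : ℕ} {dist off dist' off' : ℕ → ℝ}
    {pred rank pred' rank' : ℕ → ℕ} (h : SearchState w f k m dist off pred rank)
    (hw : ∀ i < k, ∀ j < k, w i (f i) ≤ w i (f j))
    (he : e < k) (her : rank e = 0) (hmin : ∀ j < k, rank j = 0 → dist e ≤ dist j)
    (hoff : off' = Function.update off e (dist e - w e (f e)))
    (hrank : rank' = Function.update rank e (m + 1))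
    (hrel : Relaxed (fun i => off' e + w e (f i)) rank' e k dist dist' pred pred') :
    SearchState w f k (m + 1) dist' off' pred' rank' := by
  have hoe : off' e = dist e - w e (f e) := by simp [hoff]
  have hre : rank' e = m + 1 := by simp [hrank]
  have hon : ∀ i, i ≠ e → off' i = off i := fun i hi => by simp [hoff, hi]
  have hrn : ∀ i, i ≠ e → rank' i = rank i := fun i hi => by simp [hrank, hi]
  have hle : ∀ i, dist' i ≤ dist i := by
    intro i
    rcases hrel i with ⟨-, -, h1, h2, -⟩ | ⟨-, h2, -⟩
    · exact h2.le.trans h1.le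
    · exact h2.le
  have hsc : ∀ i, rank' i ≠ 0 → dist' i = dist i ∧ pred' i = pred i := by
    intro i hi
    rcases hrel i with ⟨-, h1, -⟩ | ⟨-, h2⟩
    · exact absurd h1 hi
    · exact h2
  have hge : ∀ i < k, dist e ≤ off' e + w e (f i) := by
    intro i hi
    rw [hoe]
    linarith [hw e he i hi]
  have hmono : ∀ i < k, rank' i ≠ 0 → dist' i ≤ dist e := by
    intro i hi hr
    rw [(hsc i hr).1]
    by_cases hie : i = e
    · rw [hie]
    · exact h.mono i hi (hrn i hie ▸ hr) e he her
  have hkn : k ≠ e := by omega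
  refine ⟨by rw [hon k hkn, h.off_root], ?_, ?_, ?_, ?_, ?_, ?_, ?_, ?_⟩
  · intro i hi hr
    rw [(hsc i hr).1]
    by_cases hie : i = e
    · rw [hie, hoe]
    · rw [hon i hie, h.off_eq i hi (hrn i hie ▸ hr)]
  · intro i hi
    by_cases hie : i = e
    · rw [hie, hre]
    · rw [hrn i hie]; exact (h.rank_le i hi).trans (Nat.le_succ m)
  · have : ((Finset.range k).filter fun i => rank' i ≠ 0) =
        insert e ((Finset.range k).filter fun i => rank i ≠ 0) := by
      ext i
      by_cases hie : i = e
      · subst hie; simp [hre, he]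
      · simp [hrn i hie, hie]
    rw [this, Finset.card_insert_of_notMem (by simp [her]), h.card]
  · intro i hi
    rw [hon k hkn]
    exact (hle i).trans (h.le_root i hi)
  · intro r hr hrr i hi
    by_cases hre' : r = e
    · subst hre'
      rcases hrel i with ⟨-, -, -, h2, -⟩ | ⟨h1, h2, -⟩
      · exact h2.le
      · by_cases hri : rank' i = 0
        · rw [h2]
          by_contra! h3
          exact h1 ⟨hi, hri, h3⟩
        -- A scanned vertex is not relabelled, but its distance is at most `dist e`, hence at most
        -- the offer made through `e`.
        · exact (hmono i hi hri).trans (hge i hi)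
    · rw [hon r hre']
      exact (hle i).trans (h.le r hr (hrn r hre' ▸ hrr) i hi)
  · intro i hi
    rcases hrel i with ⟨-, -, -, h2, h3⟩ | ⟨-, h2, h3⟩
    · rw [h2, h3]
    · rw [h2, h3, h.dist_eq i hi]
      rcases h.pred_or i hi with h4 | ⟨-, h4, -⟩
      · rw [h4, hon k hkn]
      -- The predecessor was scanned earlier, so it is not `e` and its offset has not changed.
      · rw [hon _ (fun h5 => h4 (by rw [h5, her]))]
  · intro i hi
    rcases hrel i with ⟨-, h1, -, -, h3⟩ | ⟨-, -, h3⟩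
    · rw [h3]
      exact .inr ⟨he, by omega, fun h4 => absurd h1 h4⟩
    · rw [h3]
      rcases h.pred_or i hi with h4 | ⟨h4, h5, h6⟩
      · exact .inl h4
      · refine .inr ⟨h4, ?_⟩
        have := h.rank_le _ h4
        rw [hrn _ (fun h7 => h5 (by rw [h7, her]))]
        refine ⟨h5, fun h7 => ?_⟩
        by_cases hie : i = e
        · rw [hie, hre]; rw [hie] at this; omega
        · rw [hrn i hie] at h7 ⊢; exact h6 h7
  · intro i hi hr j hj hrj
    refine (hmono i hi hr).trans ?_
    have hje : j ≠ e := by rintro rfl; omega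
    rcases hrel j with ⟨-, -, -, h2, -⟩ | ⟨-, h2, -⟩
    · rw [h2]; exact hge j hj
    · rw [h2]; exact hmin j hj (hrn j hje ▸ hrj)

lemma runs_search (hB : 10 * (q + 1) ≤ B) (hpq : p ≤ q) {α : Store} {k : ℕ} (hk : k < p)
    (hαk : α.word .k = k) (hf : ∀ i < k, α.warr .f i < q)
    (hw : ∀ i < k, ∀ j < k, priced c (α.rarr .price) i (α.warr .f i) ≤
      priced c (α.rarr .price) i (α.warr .f j)) :
    Runs c S B search α fun β =>
      SearchState (priced c (α.rarr .price)) (α.warr .f) k k (β.rarr .dist) (β.rarr .off)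
        (β.warr .pred) (β.warr .rank) ∧
      (∀ a, a ≠ .pred → a ≠ .rank → β.warr a = α.warr a) ∧ β.rarr .price = α.rarr .price ∧
      (∀ x, x ≠ .i → x ≠ .n → x ≠ .best → β.word x = α.word x) ∧
      β.time ≤ α.time + 300 * (k + 1) * (k + 1) := by
  refine .seq ((runs_startSearch hB hpq hk hαk hf).mono fun α' h' => ?_)
  obtain ⟨h1, h2, hw', hr', hx', ht'⟩ := h'
  refine .forLoop k (fun m β =>
      SearchState (priced c (α.rarr .price)) (α.warr .f) k m (β.rarr .dist) (β.rarr .off)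
        (β.warr .pred) (β.warr .rank) ∧
      (∀ a, a ≠ .pred → a ≠ .rank → β.warr a = α.warr a) ∧ β.rarr .price = α.rarr .price ∧
      (∀ x, x ≠ .i → x ≠ .n → x ≠ .best → β.word x = α.word x) ∧ β.word .n = m ∧
      β.time ≤ α.time + 100 * (k + 1) + 200 * (k + 1) * m) (fun _ => by omega) ?_ ?_ ?_ ?_ ?_
  · rintro m β ⟨-, -, -, h, -⟩
    exact ⟨trivial, by simp [h, hαk]⟩
  · rintro m β h; exact h.2.2.2.2.1
  · simp [hr']
    exact ⟨.start h1 h2, hw', by simp +contextual [hx'], by omega⟩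
  · rintro m β hm ⟨h, hw2, hr2, hx2, hn, ht⟩
    refine .seq ((runs_findNearest hB hpq hk (by simp [hx2, hαk])).mono fun γ hγ => ?_)
    obtain ⟨g1, g2, g3, g4, g5⟩ := hγ
    simp at g1 g2 g3 g4 g5
    obtain ⟨i, hi, hri⟩ := h.exists_unscanned hm
    have he := (g1.min i hi hri).1
    refine (runs_scanNearest (e := γ.word .best) (m := m) hB hpq hk (by simp [g4, hx2, hαk])
      (by simpa [g2, hw2] using hf) he rfl hm (by simp [g4, hn])).mono ?_
    rintro δ ⟨d1, d2, d3, d4, d5, d6, d7⟩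
    rw [g2] at d2 d4
    rw [g3] at d5
    rw [g2, g3] at d1 d3
    simp [hr2, hw2, -Function.update_self] at d1 d2 d3 d5
    simp [d5, d6, g4, hn]
    refine ⟨h.scan hw he (g1.unscanned he) (fun j hj hr => (g1.min j hj hr).2) d1 d2 d3,
      fun a h1 h2 => by rw [d4 a h1 h2, hw2 a h1 h2], by simp +contextual [d6, g4, hx2], ?_⟩
    linarith
  · rintro β ⟨h, hw2, hr2, hx2, hn, ht⟩
    simp [hr2]
    exact ⟨h, hw2, hx2, by linarith [Nat.mul_pos k.succ_pos k.succ_pos]⟩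

/-! ## Augmentation -/

/-- Find the end `vf` of a shortest path from the left vertex `k` to a free right vertex, the vertex
`pf` before it, and its length `delta`. -/
def findFree : Prog :=
  .seq (.setWord .vf (.var .q)) (.forLoop .u (.add (.var .k) (.lit 1)) (.forLoop .b (.var .nb)
    (.seq (.setWord .v (.get .blk (.add (.mul (.var .u) (.var .nb)) (.var .b))))
    (.ite (.lt (.var .v) (.var .q))
      (.seq (.setReal .cand (.add (.get .off (.var .u)) (.weight (.var .u) (.var .v))))
      (.ite (.eq (.var .vf) (.var .q))
        (.seq (.setReal .delta (.var .cand)) (.seq (.setWord .vf (.var .v)) (.setWord .pf (.var .u))))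
        (.ite (.rlt (.var .cand) (.var .delta))
          (.seq (.setReal .delta (.var .cand))
            (.seq (.setWord .vf (.var .v)) (.setWord .pf (.var .u)))) .skip)))
      .skip))))

/-- Among the paths that continue from a left vertex `u` to a free right vertex in block `b`, where
`P u b`, the path via `pf` to `vf` is shortest and has length `delta`; there is none if `vf = q`. -/
structure IsBestFree (c : Fin p → Fin q → ℝ) (taken : ℕ → ℕ) (off : ℕ → ℝ) (k : ℕ)
    (P : ℕ → ℕ → Prop) (vf pf : ℕ) (delta : ℝ) : Prop where
  le : vf ≤ q
  free : vf < q → taken vf = 0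
  pf_le : vf < q → pf ≤ k
  eq : vf < q → delta = off pf + extendWeight c pf vf
  min : ∀ u, ∀ v < q, P u (v / p) → taken v = 0 → vf < q ∧ delta ≤ off u + extendWeight c u v

lemma IsBestFree.congr {taken : ℕ → ℕ} {off : ℕ → ℝ} {k : ℕ} {P P' : ℕ → ℕ → Prop} {vf pf : ℕ}
    {delta : ℝ} (h : IsBestFree c taken off k P vf pf delta)
    (hP : ∀ u v, v < q → P' u (v / p) → P u (v / p)) : IsBestFree c taken off k P' vf pf delta :=
  ⟨h.le, h.free, h.pf_le, h.eq, fun u v hv hu ht => h.min u v hv (hP u v hv hu) ht⟩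

/-- For a fixed `u` the offset is constant, so the stored minimum `e` of a block stands for all free
vertices of that block. -/
lemma IsBestFree.extend {taken : ℕ → ℕ} {off : ℕ → ℝ} {k : ℕ} {P P' : ℕ → ℕ → Prop} {vf pf : ℕ}
    {delta : ℝ} (h : IsBestFree c taken off k P vf pf delta) {u b e : ℕ}
    (he : IsBlockMin c taken u b q e) (hP : ∀ u' b', P' u' b' → P u' b' ∨ (u' = u ∧ b' = b))
    (hl : e < q → vf < q ∧ delta ≤ off u + extendWeight c u e) :
    IsBestFree c taken off k P' vf pf delta := by
  refine ⟨h.le, h.free, h.pf_le, h.eq, fun u' v hv hu ht => ?_⟩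
  rcases hP _ _ hu with h1 | ⟨rfl, h1⟩
  · exact h.min u' v hv h1 ht
  · obtain ⟨h2, h3⟩ := he.min v hv hv h1 ht
    exact ⟨(hl h2).1, by linarith [(hl h2).2]⟩

lemma IsBestFree.replace {taken : ℕ → ℕ} {off : ℕ → ℝ} {k : ℕ} {P P' : ℕ → ℕ → Prop} {vf pf : ℕ}
    {delta : ℝ} (h : IsBestFree c taken off k P vf pf delta) {u b e : ℕ}
    (he : IsBlockMin c taken u b q e) (hP : ∀ u' b', P' u' b' → P u' b' ∨ (u' = u ∧ b' = b))
    (hu : u ≤ k) (heq : e < q) (hl : vf = q ∨ off u + extendWeight c u e < delta) :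
    IsBestFree c taken off k P' e u (off u + extendWeight c u e) := by
  refine ⟨heq.le, he.free, fun _ => hu, fun _ => rfl, fun u' v hv hu ht => ⟨heq, ?_⟩⟩
  rcases hP _ _ hu with h1 | ⟨rfl, h1⟩
  · obtain ⟨h2, h3⟩ := h.min u' v hv h1 ht
    rcases hl with hl | hl
    · omega
    · exact hl.le.trans h3
  · linarith [(he.min v hv hv h1 ht).2]

lemma runs_findFree (hB : 10 * (q + 1) ≤ B) (hpq : p ≤ q) {α : Store} (hα : HasSizes p q α) {k : ℕ}
    (hk : k < p) (hαk : α.word .k = k) (hblk : BlocksCorrect c α)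
    (hex : ∃ v < q, α.warr .taken v = 0) :
    Runs c S B findFree α fun β =>
      IsBestFree c (α.warr .taken) (α.rarr .off) k (fun u _ => u ≤ k) (β.word .vf) (β.word .pf)
        (β.real .delta) ∧ β.word .vf < q ∧
      β.warr = α.warr ∧ β.rarr = α.rarr ∧
      (∀ x, x ≠ .u → x ≠ .b → x ≠ .v → x ≠ .vf → x ≠ .pf → β.word x = α.word x) ∧
      β.time ≤ α.time + 200 * (k + 2) * (q / p + 2) := by
  have hqp := Nat.div_le_self q p
  refine .seq (.setWord trivial (.forLoop (k + 1) (fun m β =>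
      IsBestFree c (α.warr .taken) (α.rarr .off) k (fun u _ => u < m) (β.word .vf) (β.word .pf)
        (β.real .delta) ∧ β.warr = α.warr ∧ β.rarr = α.rarr ∧
      (∀ x, x ≠ .u → x ≠ .b → x ≠ .v → x ≠ .vf → x ≠ .pf → β.word x = α.word x) ∧
      β.word .u = m ∧ β.time ≤ α.time + 10 + 200 * (q / p + 2) * m)
      (fun _ => by omega) ?_ ?_ ?_ ?_ ?_))
  · rintro m β ⟨-, -, -, h, -⟩
    simp [h, hαk]; omega
  · rintro m β h; exact h.2.2.2.2.1
  · simp +contextual [hα.right]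
    exact ⟨le_rfl, by simp, by simp, by simp, by simp⟩
  · rintro m β hm ⟨h, hw, hr, hx, hu, ht⟩
    refine .forLoop (q / p + 1) (fun l β =>
        IsBestFree c (α.warr .taken) (α.rarr .off) k (fun u b => u < m ∨ (u = m ∧ b < l))
          (β.word .vf) (β.word .pf) (β.real .delta) ∧ β.warr = α.warr ∧ β.rarr = α.rarr ∧
        (∀ x, x ≠ .u → x ≠ .b → x ≠ .v → x ≠ .vf → x ≠ .pf → β.word x = α.word x) ∧
        β.word .u = m ∧ β.word .b = l ∧
        β.time ≤ α.time + 40 + 200 * (q / p + 2) * m + 120 * l)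
        (fun _ => by omega) ?_ ?_ ?_ ?_ ?_
    · rintro m β ⟨-, -, -, h, -⟩
      exact ⟨trivial, by simp [h, hα.blocks]⟩
    · rintro m β h; exact h.2.2.2.2.2.1
    · simp [hw, hr, hu]
      exact ⟨h, by simp +contextual [hx], by omega⟩
    · clear h hw hr hx hu ht β
      rintro l β hl ⟨h, hw, hr, hx, hu, hb, ht⟩
      have hmk : m ≤ k := by omega
      have haddr := block_address_lt hpq (show m < p by omega) hl
      have e1 : β.word .nb = q / p + 1 := by simp [hx, hα.blocks]
      have e2 : β.word .q = q := by simp [hx, hα.right]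
      have he := hblk m (by omega) l hl
      have hP : ∀ u' b', (u' < m ∨ (u' = m ∧ b' < l + 1)) →
        (u' < m ∨ (u' = m ∧ b' < l)) ∨ (u' = m ∧ b' = l) := by omega
      have hle := h.le
      refine .seq (.setWord (by simp [hu, hb, e1]; omega) ?_)
      refine .ite ⟨trivial, trivial⟩ (fun h1 => ?_) (fun h1 => ?_) <;>
        simp [hu, hb, e1, e2, hw] at h1
      · refine .seq (.setReal (by simp [hu, hb, e1, hw]; omega) ?_)
        refine .ite ⟨trivial, trivial⟩ (fun h2 => ?_) (fun h2 => ?_) <;> simp [e2] at h2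
        · refine .seq (.setReal trivial (.seq (.setWord trivial (.setWord trivial ?_))))
          simp [hu, hb, e1, hw, hr, -Order.lt_add_one_iff]
          exact ⟨h.replace he hP hmk h1 (.inl h2), by simp +contextual [hx], by omega⟩
        · refine .ite ⟨trivial, trivial⟩ (fun h3 => ?_) (fun h3 => ?_) <;>
            simp [hu, hb, e1, hw, hr] at h3
          · refine .seq (.setReal trivial (.seq (.setWord trivial (.setWord trivial ?_))))
            simp [hu, hb, e1, hw, hr, -Order.lt_add_one_iff]
            exact ⟨h.replace he hP hmk h1 (.inr h3), by simp +contextual [hx], by omega⟩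
          · refine .skip ?_
            simp [hu, hb, e1, hw, hr, -Order.lt_add_one_iff]
            exact ⟨h.extend he hP fun _ => ⟨by omega, h3⟩, by simp +contextual [hx], by omega⟩
      · refine .skip ?_
        simp [hu, hb, e1, hw, hr, -Order.lt_add_one_iff]
        exact ⟨h.extend he hP fun _ => by omega, by simp +contextual [hx], by omega⟩
    · clear h hw hr hx hu ht β
      rintro β ⟨h, hw, hr, hx, hu, hb, ht⟩
      simp [hu, hw, hr, -Order.lt_add_one_iff]
      refine ⟨h.congr fun u v hv hu => ?_, by simp +contextual [hx], by linarith⟩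
      -- Every right vertex lies in one of the blocks `0, …, q / p`, so `u = m` is now completely
      -- treated.
      have := Nat.div_le_div_right (c := p) hv.le
      omega
  · rintro β ⟨h, hw, hr, hx, hu, ht⟩
    simp [hw, hr]
    obtain ⟨v, hv, hv0⟩ := hex
    exact ⟨h.congr fun u v _ hu => by omega, (h.min 0 v hv (by omega) hv0).1, hx, by linarith [Nat.zero_le (q / p)]⟩

/-! ### Price update. -/

/-- Raise the prices of the matched right vertices that are nearer than `delta`. -/
def raisePrices : Prog :=
  .forLoop .i (.var .k) (.ite (.rlt (.get .dist (.var .i)) (.var .delta))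
    (.putReal .price (.get .f (.var .i)) (.add (.get .price (.get .f (.var .i)))
      (.sub (.var .delta) (.get .dist (.var .i))))) .skip)

lemma runs_raisePrices (hB : 10 * (q + 1) ≤ B) (hpq : p ≤ q) {α : Store} {k : ℕ} (hk : k < p)
    (hαk : α.word .k = k) (hf : ∀ i < k, α.warr .f i < q)
    (hinj : Set.InjOn (α.warr .f) (Set.Iio k)) :
    Runs c S B raisePrices α fun β =>
      (∀ i < k, β.rarr .price (α.warr .f i) =
        α.rarr .price (α.warr .f i) + max 0 (α.real .delta - α.rarr .dist i)) ∧
      (∀ v, (∀ i < k, α.warr .f i ≠ v) → β.rarr .price v = α.rarr .price v) ∧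
      β.warr = α.warr ∧ (∀ x, x ≠ .i → β.word x = α.word x) ∧
      β.time ≤ α.time + 70 * (k + 1) := by
  refine .forLoop k (fun m β =>
      (∀ i < k, β.rarr .price (α.warr .f i) = if i < m then
        α.rarr .price (α.warr .f i) + max 0 (α.real .delta - α.rarr .dist i) else
        α.rarr .price (α.warr .f i)) ∧
      (∀ v, (∀ i < k, α.warr .f i ≠ v) → β.rarr .price v = α.rarr .price v) ∧
      β.rarr .dist = α.rarr .dist ∧ β.real = α.real ∧
      β.warr = α.warr ∧ (∀ x, x ≠ .i → β.word x = α.word x) ∧ β.word .i = m ∧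
      β.time ≤ α.time + 10 + 70 * m) (fun _ => by omega) ?_ ?_ ?_ ?_ ?_
  · rintro m β ⟨-, -, -, -, -, h, -⟩
    exact ⟨trivial, by simp [h, hαk]⟩
  · rintro m β h; exact h.2.2.2.2.2.2.1
  · simp +contextual
  · rintro m β hm ⟨h1, h2, hd, hre, hw, hx, hi, ht⟩
    have hfm := hf m hm
    have h3 := h1 m hm
    simp only [lt_irrefl, if_false] at h3
    refine .ite (by simp [hi]; omega) (fun h4 => ?_) (fun h4 => ?_) <;> simp [hi, hd, hre] at h4
    · refine .putReal (by simp [hi]; omega) (by simp [hi, hw]; omega) (by simp [hi, hw]; omega) ?_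
      simp [hi, hw, hre, hd, -Order.lt_add_one_iff]
      refine ⟨fun i hik => ?_, fun v hv => ?_, by simp +contextual [hx], by omega⟩
      · by_cases him : i = m
        · subst him
          simp [h3, max_eq_right (sub_nonneg.2 h4.le)]
        -- Injectivity of the matching ensures that no price is raised twice.
        · have : α.warr .f i ≠ α.warr .f m := fun h => him (hinj hik hm h)
          rw [Function.update_of_ne this, h1 i hik]
          simp only [show i < m + 1 ↔ i < m by omega]
      · rw [Function.update_of_ne (Ne.symm (hv m hm)), h2 v hv]
    · refine .skip ?_
      simp [hi, hw, hre, hd, -Order.lt_add_one_iff]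
      refine ⟨fun i hik => ?_, h2, by simp +contextual [hx], by omega⟩
      by_cases him : i = m
      · subst him
        simp [h3, h4]
      · rw [h1 i hik]
        simp only [show i < m + 1 ↔ i < m by omega]
  · rintro β ⟨h1, h2, hd, hre, hw, hx, hi, ht⟩
    simp [hw]
    exact ⟨fun i hi => by rw [h1 i hi, if_pos hi], h2, hx, by omega⟩

/-! ### Augmentation along the path found. -/

/-- Change the matching along the path that ends in `pf` and `vf`. -/
def augment : Prog :=
  .seq (.putWord .taken (.var .vf) (.lit 1)) (.seq (.setWord .i (.var .pf))
    (.seq (.setWord .v (.var .vf)) (.seq (.whileLoop (.lt (.var .i) (.var .k))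
      (.seq (.setWord .j (.get .f (.var .i))) (.seq (.putWord .f (.var .i) (.var .v))
        (.seq (.setWord .v (.var .j)) (.setWord .i (.get .pred (.var .i)))))))
    (.putWord .f (.var .k) (.var .v)))))

/-- The right vertex waiting for a partner is regarded as parked at position `k`. One step of the
augmentation then merely swaps the values at `i` and `k`. -/
lemma bijOn_update_swap {f : ℕ → ℕ} {k i v : ℕ} {X : Set ℕ} (hi : i < k)
    (h : Set.BijOn (Function.update f k v) (Set.Iic k) X) :
    Set.BijOn (Function.update (Function.update f i v) k (f i)) (Set.Iic k) X := by
  have hs : Set.BijOn (Equiv.swap i k) (Set.Iic k) (Set.Iic k) := by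
    refine ⟨fun j hj => ?_, (Equiv.swap i k).injective.injOn, fun j hj => ⟨Equiv.swap i k j, ?_, by simp⟩⟩
    all_goals
      simp only [Set.mem_Iic, Equiv.swap_apply_def] at hj ⊢
      split_ifs <;> omega
  convert h.comp hs using 1
  ext j
  simp only [Function.comp, Equiv.swap_apply_def, Function.update_apply]
  split_ifs <;> first | rfl | omega

/-- `On` and `Good` keep distances and prices out of the loop: `On` is a property inherited along
the path towards the root, and `Good` is the property wanted of each new matching edge. -/
lemma runs_augment (hB : 10 * (q + 1) ≤ B) (hpq : p ≤ q) {α : Store} {k : ℕ} (hk : k < p)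
    (hαk : α.word .k = k) {vf : ℕ} (hαvf : α.word .vf = vf) (hvf : vf < q) {X : Set ℕ}
    (hX : Set.BijOn (Function.update (α.warr .f) k vf) (Set.Iic k) X)
    (On : ℕ → Prop) (Good : ℕ → ℕ → Prop) (hpf : α.word .pf ≤ k) (hon : On (α.word .pf))
    (hgood : Good (α.word .pf) vf) (hrank : ∀ i < k, 0 < α.warr .rank i ∧ α.warr .rank i ≤ k)
    (hpred : ∀ i < k, α.warr .pred i = k ∨
      (α.warr .pred i < k ∧ α.warr .rank (α.warr .pred i) < α.warr .rank i))
    (hstep : ∀ i < k, On i → On (α.warr .pred i) ∧ Good (α.warr .pred i) (α.warr .f i)) :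
    Runs c S B augment α fun β =>
      Set.BijOn (β.warr .f) (Set.Iic k) X ∧
      (∀ i ≤ k, (i < k ∧ β.warr .f i = α.warr .f i) ∨ Good i (β.warr .f i)) ∧
      β.warr .taken = Function.update (α.warr .taken) vf 1 ∧ β.warr .blk = α.warr .blk ∧
      β.rarr = α.rarr ∧ (∀ x, x ≠ .i → x ≠ .j → x ≠ .v → β.word x = α.word x) ∧
      β.time ≤ α.time + 100 * (k + 1) := by
  refine .seq (.putWord trivial (by simp; omega) (by simp [hαvf]; omega)
    (.seq (.setWord trivial (.seq (.setWord trivial (.seq (.whileLoop (fun m β =>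
      Set.BijOn (Function.update (β.warr .f) k (β.word .v)) (Set.Iic k) X ∧
      -- Ranks decrease towards the root, so the rank is a variant and bounds the number of rounds
      -- by `k`.
      β.word .i ≤ k ∧ m = (if β.word .i < k then α.warr .rank (β.word .i) else 0) ∧
      On (β.word .i) ∧ Good (β.word .i) (β.word .v) ∧
      (∀ j < k, j ≠ β.word .i → β.warr .f j = α.warr .f j ∨ Good j (β.warr .f j)) ∧
      -- Vertices still ahead on the path have not been rematched, since all earlier ones have
      -- larger rank.
      (β.word .i < k → ∀ j < k, α.warr .rank j ≤ α.warr .rank (β.word .i) →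
        β.warr .f j = α.warr .f j) ∧
      β.warr .taken = Function.update (α.warr .taken) vf 1 ∧ β.warr .blk = α.warr .blk ∧
      β.warr .pred = α.warr .pred ∧
      β.rarr = α.rarr ∧ (∀ x, x ≠ .i → x ≠ .j → x ≠ .v → β.word x = α.word x) ∧
      β.time + 60 * m ≤ α.time + 40 + 60 * k) ?_ ?_ ?_
      (m := if α.word .pf < k then α.warr .rank (α.word .pf) else 0) ?_)))))))
  · exact fun m β _ => ⟨trivial, trivial⟩
  · rintro m β ⟨h1, h2, hm, h3, h4, h5, h6, ht, hb, hp, hr, hx, htime⟩ hi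
    simp [hx, hαk] at hi
    simp only [hi, if_true] at hm
    have hri := hrank _ hi
    have hfi := h6 hi _ hi le_rfl
    refine .seq (.setWord (by simp; omega) (.seq (.putWord trivial trivial (by simp; omega)
      (.seq (.setWord trivial (.setWord (by simp; omega) ?_))))))
    simp [ht, hb, hp, hr]
    obtain ⟨s1, s2⟩ := hstep _ hi h3
    have hpr := hpred _ hi
    refine ⟨by split_ifs <;> omega, bijOn_update_swap hi h1, by omega, s1, hfi ▸ s2,
      fun j hj hjp => ?_, fun hpk j hj hjr => ?_, by simp +contextual [hx], by split_ifs <;> omega⟩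
    · by_cases hji : j = β.word .i
      · subst hji; simpa using .inr h4
      · simpa [hji] using h5 j hj hji
    · have hji : j ≠ β.word .i := by rintro rfl; omega
      rw [Function.update_of_ne hji]
      exact h6 hi j hj (by omega)
  · rintro m β ⟨h1, h2, hm, h3, h4, h5, h6, ht, hb, hp, hr, hx, htime⟩ hi
    simp [hx, hαk] at hi
    have hik : β.word .i = k := le_antisymm h2 hi
    refine .putWord trivial trivial (by simp [hx, hαk]; omega) ?_
    simp [hx, hαk, ht, hb, hr]
    refine ⟨h1, fun i hi' => ?_, hx, by omega⟩
    by_cases hii : i = k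
    · subst hii; rw [hik] at h4; simpa using h4
    · have hlt : i < k := by omega
      simpa [hii, hlt] using h5 i hlt (by omega)
  · simp [hαvf]
    refine ⟨hX, hpf, hon, hgood, by simp +contextual, ?_⟩
    split_ifs with h
    · have := hrank _ h; omega
    · omega

/-! ### Equilibrium prices and optimality. -/

/-- `f` matches the left vertices below `k` to the right vertices with `taken ≠ 0`; only these have
prices other than `0`, and every left vertex below `k` is matched as cheaply as the prices admit. -/
structure Equilibrium (c : Fin p → Fin q → ℝ) (taken f : ℕ → ℕ) (price : ℕ → ℝ) (k : ℕ) :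
    Prop where
  bij : Set.BijOn f (Set.Iio k) {v | v < q ∧ taken v ≠ 0}
  nonneg : ∀ v < q, 0 ≤ price v
  free : ∀ v < q, taken v = 0 → price v = 0
  le : ∀ i < k, ∀ v < q, priced c price i (f i) ≤ priced c price i v

namespace Equilibrium

variable {taken f : ℕ → ℕ} {price : ℕ → ℝ} {k : ℕ}

lemma lt (h : Equilibrium c taken f price k) {i : ℕ} (hi : i < k) : f i < q :=
  (h.bij.mapsTo hi).1

lemma taken_ne (h : Equilibrium c taken f price k) {i : ℕ} (hi : i < k) : taken (f i) ≠ 0 :=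
  (h.bij.mapsTo hi).2

lemma exists_free (h : Equilibrium c taken f price k) (hk : k < q) : ∃ v < q, taken v = 0 := by
  by_contra! h'
  have h1 : {v | v < q ∧ taken v ≠ 0} = Set.Iio q := by
    ext v; simpa using h' v
  have h2 := h.bij.image_eq
  have h3 := h.bij.injOn.ncard_image
  rw [h2, h1] at h3
  simp [← Finset.coe_Iio, Set.ncard_coe_finset] at h3
  omega

/-- Weak duality: sum `c u (f u) + price (f u) ≤ c u (g u) + price (g u)` over `u`. The prices on
the left add up to the total of all prices, since unmatched vertices have price `0`; those on the
right add up to at most this total, since `g` is injective and prices are nonnegative. -/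
lemma cheapest (h : Equilibrium c taken f price p) :
    ∃ g : Fin p ↪ Fin q, IsCheapestMatching c g ∧ ∀ u : Fin p, f u = g u := by
  refine ⟨⟨fun u => ⟨f u, h.lt u.2⟩, fun u v huv => ?_⟩, fun g => ?_, fun u => rfl⟩
  · exact Fin.ext (h.bij.injOn u.2 v.2 (by simpa using huv))
  · change ∑ u : Fin p, c u ⟨f u, h.lt u.2⟩ ≤ ∑ u, c u (g u)
    have h1 : ∀ u : Fin p, c u ⟨f u, h.lt u.2⟩ + price (f u) ≤ c u (g u) + price (g u) := by
      intro u
      have := h.le u u.2 (g u) (g u).2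
      simpa [priced, extendWeight, h.lt u.2] using this
    have h2 := Finset.sum_le_sum fun u (_ : u ∈ Finset.univ) => h1 u
    rw [Finset.sum_add_distrib, Finset.sum_add_distrib] at h2
    have h3 : ∑ u : Fin p, price (f u) = ∑ v : Fin q, price v := by
      rw [← Finset.sum_subset (Finset.subset_univ (Finset.univ.image
        fun u : Fin p => (⟨f u, h.lt u.2⟩ : Fin q))), Finset.sum_image]
      · intro u _ v _ huv
        exact Fin.ext (h.bij.injOn u.2 v.2 (by simpa using huv))
      · intro v _ hv
        refine h.free v v.2 ?_
        by_contra h0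
        obtain ⟨u, hu, huv⟩ := h.bij.surjOn ⟨v.2, h0⟩
        exact hv (Finset.mem_image.2 ⟨⟨u, hu⟩, Finset.mem_univ _, Fin.ext huv⟩)
    have h4 : ∑ u : Fin p, price (g u) ≤ ∑ v : Fin q, price v := by
      rw [← Finset.sum_map Finset.univ g fun v : Fin q => price v]
      exact Finset.sum_le_sum_of_subset_of_nonneg (Finset.subset_univ _)
        fun v _ _ => h.nonneg v v.2
    linarith

/-- The prices `price'` arise from `price` by raising the prices along shortest paths shorter than
`delta`, the length of a shortest path to a free right vertex. -/
structure Raised (c : Fin p → Fin q → ℝ) (taken f : ℕ → ℕ) (price : ℕ → ℝ) (k : ℕ)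
    (dist off : ℕ → ℝ) (pred rank : ℕ → ℕ) (vf pf : ℕ) (delta : ℝ) (price' : ℕ → ℝ) : Prop where
  equilibrium : Equilibrium c taken f price k
  search : SearchState (priced c price) f k k dist off pred rank
  vf_lt : vf < q
  best : IsBestFree c taken off k (fun u _ => u ≤ k) vf pf delta
  matched : ∀ i < k, price' (f i) = price (f i) + max 0 (delta - dist i)
  unmatched : ∀ v, (∀ i < k, f i ≠ v) → price' v = price v

namespace Raised

variable {dist off price' : ℕ → ℝ} {pred rank : ℕ → ℕ} {vf pf : ℕ} {delta : ℝ}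

lemma price_free (h : Raised c taken f price k dist off pred rank vf pf delta price') {v : ℕ}
    (hv : v < q) (ht : taken v = 0) : price' v = 0 := by
  rw [h.unmatched v fun i hi h' => h.equilibrium.taken_ne hi (h' ▸ ht),
    h.equilibrium.free v hv ht]

lemma price_le (h : Raised c taken f price k dist off pred rank vf pf delta price') (v : ℕ) :
    price v ≤ price' v := by
  by_cases hv : ∃ i < k, f i = v
  · obtain ⟨i, hi, rfl⟩ := hv
    rw [h.matched i hi]
    linarith [le_max_left 0 (delta - dist i)]
  · push Not at hv
    rw [h.unmatched v hv]

lemma dist_eq_off (h : Raised c taken f price k dist off pred rank vf pf delta price') {i : ℕ}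
    (hi : i < k) : dist i = off i + priced c price i (f i) := by
  rw [h.search.off_eq i hi (h.search.all_scanned i hi)]; ring

lemma dist_le (h : Raised c taken f price k dist off pred rank vf pf delta price') {u i : ℕ}
    (hu : u ≤ k) (hi : i < k) : dist i ≤ off u + priced c price u (f i) := by
  rcases hu.lt_or_eq with hu | rfl
  · exact h.search.le u hu (h.search.all_scanned u hu) i hi
  · exact h.search.le_root i hi

/-- For free `v` this is the minimality of `delta`. For `v = f i` the old length is at least `dist
i`, and the price has risen by at least `delta - dist i`. -/
lemma delta_le (h : Raised c taken f price k dist off pred rank vf pf delta price') {u v : ℕ}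
    (hu : u ≤ k) (hv : v < q) : delta ≤ off u + priced c price' u v := by
  by_cases ht : taken v = 0
  · rw [priced, h.price_free hv ht, add_zero]
    exact (h.best.min u v hv hu ht).2
  · obtain ⟨i, hi, rfl⟩ := h.equilibrium.bij.surjOn ⟨hv, ht⟩
    have h1 := h.dist_le hu hi
    rw [priced] at h1 ⊢
    rw [h.matched i hi]
    linarith [le_max_right 0 (delta - dist i)]

lemma tight_last (h : Raised c taken f price k dist off pred rank vf pf delta price') :
    off pf + priced c price' pf vf = delta := by
  rw [priced, h.price_free h.vf_lt (h.best.free h.vf_lt), add_zero, h.best.eq h.vf_lt]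

/-- In the old equilibrium `pf` prefers `f pf` to `vf`, so the path has nonnegative reduced length
after `f pf`. -/
lemma dist_last (h : Raised c taken f price k dist off pred rank vf pf delta price')
    (hpf : pf < k) : dist pf ≤ delta := by
  have h1 := h.equilibrium.le pf hpf vf h.vf_lt
  have h2 := h.dist_eq_off hpf
  have h3 := h.best.eq h.vf_lt
  rw [priced, priced, h.equilibrium.free vf h.vf_lt (h.best.free h.vf_lt)] at h1
  rw [priced] at h2
  linarith

/-- The edge by which the search reaches `f i` has old length exactly `dist i`, and the price rise
lifts this to exactly `delta`. -/
lemma tight_pred (h : Raised c taken f price k dist off pred rank vf pf delta price') {i : ℕ}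
    (hi : i < k) (hd : dist i ≤ delta) : off (pred i) + priced c price' (pred i) (f i) = delta := by
  have h1 := h.search.dist_eq i hi
  rw [priced] at h1 ⊢
  rw [h.matched i hi, max_eq_right (sub_nonneg.2 hd)]
  linarith

lemma dist_pred (h : Raised c taken f price k dist off pred rank vf pf delta price') {i : ℕ}
    (hi : i < k) (hp : pred i < k) : dist (pred i) ≤ dist i := by
  have h1 := h.search.dist_eq i hi
  have h2 := h.equilibrium.le _ hp (f i) (h.equilibrium.lt hi)
  have h3 := h.dist_eq_off hp
  linarith

lemma bijOn_update (h : Raised c taken f price k dist off pred rank vf pf delta price') :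
    Set.BijOn (Function.update f k vf) (Set.Iic k)
      {v | v < q ∧ Function.update taken vf 1 v ≠ 0} := by
  have ht := h.best.free h.vf_lt
  have h1 : {v | v < q ∧ Function.update taken vf 1 v ≠ 0} =
      insert vf {v | v < q ∧ taken v ≠ 0} := by
    ext v
    by_cases hv : v = vf
    · subst hv; simp [h.vf_lt]
    · simp [hv]
  have h2 : Set.Iic k = insert k (Set.Iio k) := by ext; simp [le_iff_eq_or_lt]
  have h3 : Set.BijOn (Function.update f k vf) (Set.Iio k) {v | v < q ∧ taken v ≠ 0} :=
    h.equilibrium.bij.congr fun i hi => by simp [(show i < k from hi).ne]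
  rw [h1, h2]
  simpa using h3.insert (a := k) (by simp [ht])

/-- A vertex with a tight edge attains the lower bound of `delta_le`. A vertex that keeps its
partner has a tight edge if `dist i ≤ delta`; otherwise its partner's price is unchanged while the
other prices can only have risen. -/
lemma equilibrium_succ (h : Raised c taken f price k dist off pred rank vf pf delta price')
    {f' : ℕ → ℕ} (hbij : Set.BijOn f' (Set.Iic k) {v | v < q ∧ Function.update taken vf 1 v ≠ 0})
    (hf' : ∀ i ≤ k, (i < k ∧ f' i = f i) ∨ off i + priced c price' i (f' i) = delta) :
    Equilibrium c (Function.update taken vf 1) f' price' (k + 1) where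
  bij := by rwa [show Set.Iio (k + 1) = Set.Iic k by ext; simp]
  nonneg v hv := (h.equilibrium.nonneg v hv).trans (h.price_le v)
  free v hv ht := by
    have hvf : v ≠ vf := by rintro rfl; simp at ht
    exact h.price_free hv (by simpa [hvf] using ht)
  le i hi v hv := by
    have h1 := h.delta_le (Nat.lt_succ_iff.1 hi) hv
    rcases hf' i (Nat.lt_succ_iff.1 hi) with ⟨hik, h2⟩ | h2
    · rw [h2]
      have h3 := h.dist_eq_off hik
      have h4 := h.matched i hik
      have h5 := h.equilibrium.le i hik v hv
      have h6 := h.price_le v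
      simp only [priced] at *
      rcases le_total (delta - dist i) 0 with h7 | h7
      · rw [max_eq_left h7] at h4
        linarith
      · rw [max_eq_right h7] at h4
        linarith
    · linarith

end Raised

end Equilibrium

/-! ## The program -/

/-- Match the left vertex `k`. -/
def matchNext : Prog :=
  .seq search (.seq findFree (.seq raisePrices (.seq augment
    (.seq (.setWord .b (.div (.var .vf) (.var .p))) findBlockMins))))

/-- Taking a vertex of another block affects neither the stored minimum nor its competitors, so one
block per phase needs recomputation. -/
lemma IsBlockMin.take {taken : ℕ → ℕ} {u b l e vf : ℕ} (h : IsBlockMin c taken u b l e)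
    (hb : vf / p ≠ b) : IsBlockMin c (Function.update taken vf 1) u b l e where
  le := h.le
  free he := by
    have : e ≠ vf := fun h' => hb (h' ▸ h.block he)
    rw [Function.update_of_ne this, h.free he]
  block := h.block
  min v hv hvl hvb ht := by
    have : v ≠ vf := fun h' => hb (h' ▸ hvb)
    rw [Function.update_of_ne this] at ht
    exact h.min v hv hvl hvb ht

/-- The left vertices below `k` are matched. -/
structure Matched (c : Fin p → Fin q → ℝ) (k : ℕ) (α : Store) : Prop where
  sizes : HasSizes p q α
  blocks : BlocksCorrect c α
  equilibrium : Equilibrium c (α.warr .taken) (α.warr .f) (α.rarr .price) k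

lemma matchNext_time {p k : ℕ} (hk : k < p) (d : ℕ) :
    300 * (k + 1) * (k + 1) + 200 * (k + 2) * (d + 2) + 200 * (k + 1) + 100 * (p + 1) * (p + 1) ≤
      1000 * (p + 1) * (p + d + 2) := by
  obtain ⟨e, rfl⟩ := Nat.exists_eq_add_of_lt hk
  linarith [Nat.zero_le (k * k), Nat.zero_le (k * e), Nat.zero_le (e * e), Nat.zero_le (k * d),
    Nat.zero_le (e * d)]

/-- With `d = q / p`, the products reduce to `p ^ 3` and `p * q` by `p * d ≤ q` and `p ≤ q`; `0 < p`
absorbs the additive constants. -/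
lemma matchAll_time {p q d : ℕ} (hp : 0 < p) (hpq : p ≤ q) (hd : p * d ≤ q) :
    120 * (p + 1) * (p + 1) * (d + 1) + (1000 * (p + 1) * (p + d + 2) + 20) * p + 100 ≤
      20000 * (p ^ 3 + p * q + 1) := by
  have h1 : 120 * (p + 1) * (p + 1) * (d + 1) ≤ 120 * (p + p) * (p + p) * (d + 1) := by
    gcongr <;> exact hp
  have h2 : (1000 * (p + 1) * (p + d + 2) + 20) * p ≤
      (1000 * (p + p) * (p + d + (p + p)) + 20) * p := by
    gcongr <;> omega
  have h3 : p * (p * d) ≤ p * q := Nat.mul_le_mul_left _ hd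
  have h4 : p * p ≤ p * q := Nat.mul_le_mul_left _ hpq
  have h5 : p ≤ p * p := Nat.le_mul_of_pos_left _ hp
  linarith [Nat.zero_le (p ^ 3)]

lemma runs_matchNext (hB : 10 * (q + 1) ≤ B) (hpq : p ≤ q) {α : Store} {k : ℕ} (hk : k < p)
    (hαk : α.word .k = k) (hα : Matched c k α) :
    Runs c S B matchNext α fun β => Matched c (k + 1) β ∧ β.word .k = k ∧
      β.time ≤ α.time + 1000 * (p + 1) * (p + q / p + 2) := by
  have hf : ∀ i < k, α.warr .f i < q := fun i hi => hα.equilibrium.lt hi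
  refine .seq ((runs_search hB hpq hk hαk hf fun i hi j hj =>
    hα.equilibrium.le i hi _ (hf j hj)).mono ?_)
  rintro α₁ ⟨hs, w1, r1, x1, t1⟩
  have s1 : HasSizes p q α₁ := hα.sizes.of_eq (by simp [x1]) (by simp [x1]) (by simp [x1])
  have k1 : α₁.word .k = k := by simp [x1, hαk]
  refine .seq ((runs_findFree hB hpq s1 hk k1 (by simpa [BlocksCorrect, w1] using hα.blocks)
    (by simpa [w1] using hα.equilibrium.exists_free (by omega))).mono ?_)
  rintro α₂ ⟨hbest, hvf, w2, r2, x2, t2⟩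
  have k2 : α₂.word .k = k := by simp [x2, k1]
  refine .seq ((runs_raisePrices hB hpq hk k2 (by simpa [w2, w1] using hf)
    (by simpa [w2, w1] using hα.equilibrium.bij.injOn)).mono ?_)
  rintro α₃ ⟨hm, hu, w3, x3, t3⟩
  simp [w2, w1, r2, r1] at hm hu hbest
  have k3 : α₃.word .k = k := by simp [x3, k2]
  have hR : Equilibrium.Raised c (α.warr .taken) (α.warr .f) (α.rarr .price) k (α₁.rarr .dist)
      (α₁.rarr .off) (α₁.warr .pred) (α₁.warr .rank) (α₂.word .vf) (α₂.word .pf)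
      (α₂.real .delta) (α₃.rarr .price) := ⟨hα.equilibrium, hs, hvf, hbest, hm, hu⟩
  refine .seq ((runs_augment (vf := α₂.word .vf) hB hpq hk k3 (by simp [x3]) hvf
    (by simpa [w3, w2, w1] using hR.bijOn_update)
    -- The condition is void at the root, which has no distance label of its own; below `k` it is
    -- what makes the edge into `f i` tight.
    (fun i => i < k → α₁.rarr .dist i ≤ α₂.real .delta)
    (fun i v => α₁.rarr .off i + priced c (α₃.rarr .price) i v = α₂.real .delta)
    (by simpa [x3] using hbest.pf_le hvf) (by simpa [x3] using hR.dist_last)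
    (by simpa [x3] using hR.tight_last) ?_ ?_ ?_).mono ?_)
  · intro i hi
    simp only [w3, w2]
    exact ⟨Nat.pos_of_ne_zero (hs.all_scanned i hi), hs.rank_le i hi⟩
  · intro i hi
    simp only [w3, w2]
    exact (hs.pred_or i hi).imp_right fun h => ⟨h.1, h.2.2 (hs.all_scanned i hi)⟩
  · intro i hi hd
    simp only [w3, w2, w1, ne_eq, reduceCtorEq, not_false_eq_true]
    exact ⟨fun hp => (hR.dist_pred hi hp).trans (hd hi), hR.tight_pred hi (hd hi)⟩
  rintro α₄ ⟨hbij, hor, ht4, hb4, r4, x4, t4⟩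
  simp [w3, w2, w1] at hor ht4 hb4
  have hE := hR.equilibrium_succ hbij hor
  have vf4 : α₄.word .vf = α₂.word .vf := by simp [x4, x3]
  have s4 : HasSizes p q α₄ := s1.of_eq (by simp [x4, x3, x2]) (by simp [x4, x3, x2])
    (by simp [x4, x3, x2])
  have k4 : α₄.word .k = k := by simp [x4, k3]
  have hdiv := Nat.div_le_div_right (c := p) hvf.le
  refine .seq (.setWord (by simp [s4.left]; omega) ?_)
  refine (runs_findBlockMins (b := α₂.word .vf / p) hB hpq (s4.of_eq ?_ ?_ ?_) (by omega) ?_).mono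
    ?_ <;> simp [s4.left, vf4, -Order.lt_add_one_iff]
  intro α₅ h5 h5' w5 r5 x5 t5
  refine ⟨⟨s4.of_eq (by simp [x5]) (by simp [x5]) (by simp [x5]), ?_, ?_⟩, by simp [x5, k4], ?_⟩
  · intro u hu b hb
    simp only [w5 .taken (by simp), ht4]
    by_cases hbv : b = α₂.word .vf / p
    · subst hbv
      simpa [ht4] using h5 u hu
    · rw [h5' u b hb hbv, hb4]
      exact (hα.blocks u hu b hb).take (Ne.symm hbv)
  · simpa [w5, r5, r4, ht4] using hE
  · have := matchNext_time hk (q / p)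
    omega

/-- The part of the program after the distance between arrays is stored. -/
def matchAll : Prog :=
  -- The guard avoids a division by `0`; for `p = 0` the empty matching is already the output.
  .ite (.lt (.lit 0) (.var .p))
    (.seq (.setWord .nb (.add (.div (.var .q) (.var .p)) (.lit 1)))
      (.seq findAllBlockMins (.forLoop .k (.var .p) matchNext))) .skip

/-- The whole program. -/
def assignment : Prog :=
  .seq (.seq (.wordOp .add 20 1 1) (.seq (.wordConst 21 2) (.wordOp .add 20 20 21))) matchAll

/-- The store at the start. -/
def Store.start (p q : ℕ) : Store where
  word x := if x = .p then p else if x = .q then q else 0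
  real _ := 0
  warr _ _ := 0
  rarr _ _ := 0
  time := 0

lemma Equilibrium.start : Equilibrium c (fun _ => 0) (fun _ => 0) (fun _ => 0) 0 :=
  ⟨by simp [Set.BijOn, Set.MapsTo, Set.SurjOn], by simp, by simp, by simp⟩

lemma runs_matchAll (hB : 10 * (q + 1) ≤ B) (hpq : p ≤ q) :
    Runs c S B matchAll (Store.start p q) fun β =>
      Equilibrium c (β.warr .taken) (β.warr .f) (β.rarr .price) p ∧
      β.time ≤ 20000 * (p ^ 3 + p * q + 1) := by
  have hqp := Nat.div_le_self q p
  refine .ite (by simp; omega) (fun h => ?_) (fun h => ?_) <;> simp [Store.start] at h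
  · refine .seq (.setWord (by simp [Store.start]; omega) (.seq
      ((runs_findAllBlockMins hB hpq ⟨?_, ?_, ?_⟩).mono ?_))) <;> simp [Store.start]
    intro α₁ hb w1 r1 x1 t1
    refine .forLoop p (fun m β => Matched c m β ∧ β.word .k = m ∧
      β.time ≤ α₁.time + 10 + (1000 * (p + 1) * (p + q / p + 2) + 20) * m)
      (fun _ => by omega) ?_ ?_ ?_ ?_ ?_
    · rintro m β ⟨h, -⟩
      exact ⟨trivial, h.sizes.left⟩
    · rintro m β h; exact h.2.1
    · refine ⟨⟨⟨by simp [x1], by simp [x1], by simp [x1]⟩, hb, ?_⟩, by simp, by simp⟩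
      simpa [w1, r1] using Equilibrium.start
    · rintro m β hm ⟨hβ, hk, ht⟩
      refine (runs_matchNext (k := m) (α := β.tick ((WExp.var .p).cost + 3)) hB hpq hm hk
        ⟨⟨hβ.sizes.left, hβ.sizes.right, hβ.sizes.blocks⟩, hβ.blocks, hβ.equilibrium⟩).mono ?_
      rintro γ ⟨h1, h2, h3⟩
      refine ⟨h2, ⟨⟨by simp [h1.sizes.left], by simp [h1.sizes.right], by simp [h1.sizes.blocks]⟩,
        h1.blocks, h1.equilibrium⟩, by simp, ?_⟩
      simp at h3 ⊢
      linarith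
    · rintro β ⟨hβ, -, ht⟩
      refine ⟨hβ.equilibrium, ?_⟩
      simp
      have hd : p * (q / p) ≤ q := Nat.mul_div_le q p
      have := matchAll_time h hpq hd
      omega
  · subst h
    exact .skip ⟨Equilibrium.start, by simp [Store.start]⟩

lemma rel_start (hB : 2 * q + 2 < B) (hpq : p ≤ q) :
    Rel q B (Store.start p q) ((((State.start p q).setWordReg 20 (q + q)).setWordReg 21
      2).setWordReg 20 (q + q + 2)) where
  word x := by cases x <;> simp [State.setWordReg, State.start, Store.start, WVar.idx]
  stride := by simp [State.setWordReg]; omega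
  real _ := rfl
  warr _ _ _ := rfl
  rarr _ _ _ := rfl
  reg_lt := update_lt (update_lt (update_lt (by
    intro d; simp only [State.start]; split_ifs <;> omega) _ (by omega)) _ (by omega)) _ (by omega)
  mem_lt _ := by simp [State.setWordReg, State.start]; omega

lemma exec_assignment (hS : 10 * (q + 1) ≤ S) (hB : 10 * (q + 1) ≤ B) (hpq : p ≤ q) :
    ∃ t τ, Exec c S B assignment (State.start p q) t τ ∧ t ≤ 30000 * (p ^ 3 + p * q + 1) ∧
      ∃ f : Fin p ↪ Fin q, IsCheapestMatching c f ∧ ∀ u : Fin p, τ.wordMem (u : ℕ) = (f u : ℕ) := by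
  obtain ⟨t, τ, β, h1, h2, h3, h4, h5⟩ :=
    runs_matchAll (c := c) (S := S) hB hpq hS hB _ (rel_start (by omega) hpq)
  obtain ⟨f, hf, hβ⟩ := h4.cheapest
  refine ⟨_, τ, .seq (.seq (.wordOp _ .add 20 1 1 (q + q) ?_ (by omega))
    (.seq (.wordConst _ 21 2 (by omega)) (.wordOp _ .add 20 20 21 (q + q + 2) ?_ (by omega)))) h1,
    ?_, f, hf, fun u => ?_⟩
  · simp [WordOp.eval, State.start]
  · simp [WordOp.eval, State.setWordReg]
  · simp only [Store.start] at h3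
    omega
  · rw [← hβ, ← h2.warr .f u (by omega)]
    simp [WArr.idx]

end RealRAM

theorem mainTheorem6 :
    ∃ (P : RealRAM.Prog) (C k : ℕ), ∀ (p q : ℕ), p ≤ q → ∀ c : Fin p → Fin q → ℝ,
      ∃ (t : ℕ) (τ : RealRAM.State),
        RealRAM.Exec c (C * (q + 1)) ((q + 2) ^ k) P (RealRAM.State.start p q) t τ ∧
        t ≤ C * (p ^ 3 + p * q + 1) ∧
        ∃ f : Fin p ↪ Fin q, IsCheapestMatching c f ∧
          ∀ u : Fin p, τ.wordMem (u : ℕ) = (f u : ℕ) := by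
  -- The exponent `5` serves only to give `10 * (q + 1) ≤ (q + 2) ^ 5` for every `q`, by `10 ≤ 2 ^
  -- 4`. The constant `30000` comes from the time bound and more than covers the memory.
  refine ⟨RealRAM.assignment, 30000, 5, fun p q hpq c => RealRAM.exec_assignment
    (Nat.mul_le_mul_right _ (by norm_num)) ?_ hpq⟩
  have h1 : 2 ^ 4 ≤ (q + 2) ^ 4 := Nat.pow_le_pow_left (by omega) 4
  rw [pow_succ]
  exact Nat.mul_le_mul ((by norm_num : 10 ≤ 2 ^ 4).trans h1) (by omega)
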